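/- Let $m>0$ and let $S_2$ be a scattering function: $S_2$ is analytic on the strip $S(0,\pi)=\{\zeta\in\mathbb C: 0<\operatorname{Im}\zeta<\pi\}$, bounded and continuous on its closure, and $\overline{S_2(\theta)}=S_2(\theta)^{-1}=S_2(-\theta)=S_2(\theta+i\pi)$ for all $\theta\in\mathbb R$. For a permutation $\pi$ of $\{1,\dots,n\}$ let $$(D_n(\pi)\Phi)(\theta_1,\dots,\theta_n)=\prod_{l<k,\ \pi(l)>\pi(k)}S_2(\theta_{\pi(l)}-\theta_{\pi(k)})\;\Phi(\theta_{\pi(1)},\dots,\theta_{\pi(n)}),\qquad \Phi\in L^2(\mathbb R^n),$$ and put $P_n=\frac1{n!}\sum_\pi D_n(\pi)$, $\mathcal H_n=P_nL^2(\mathbb R^n)$, $\mathcal H=\bigoplus_{n\ge 0}\mathcal H_n$, $P=\bigoplus_n P_n$. Let $\mathcal D\subset\mathcal H$ be the subspace of vectors of finite particle number ($\Psi_n=0$ for all sufficiently large $n$). For $\psi\in L^2(\mathbb R)$ let $z(\psi)=Pa(\psi)P$ and $z^\dagger(\psi)=Pa^\dagger(\psi)P$ on $\mathcal D$ be the Zamolodchikov–Faddeev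 operators, where $$(a(\psi)\Phi)_n(\theta_1,\dots,\theta_n)=\sqrt{n+1}\int d\theta\,\psi(\theta)\,\Phi_{n+1}(\theta,\theta_1,\dots,\theta_n),$$ $$(a^\dagger(\psi)\Phi)_n(\theta_1,\dots,\theta_n)=\sqrt n\,\psi(\theta_1)\,\Phi_{n-1}(\theta_2,\dots,\theta_n)\ (n\ge1),\qquad (a^\dagger(\psi)\Phi)_0=0,$$ and let $J$ be the antilinear involution $(J\Psi)_n(\theta_1,\dots,\theta_n)=\overline{\Psi_n(\theta_n,\dots,\theta_1)}$. For a Schwartz function $f\in\mathcal S(\mathbb R^2)$ (complex valued) let $$f^\pm(\theta)=\frac1{2\pi}\int d^2x\,f(\pm x)\,e^{ip(\theta)\cdot x},\qquad p(\theta)=m(\cosh\theta,\sinh\theta),\quad x\cdot y=x_0y_0-x_1y_1,$$ $$\phi(f)=z^\dagger(f^+)+z(f^-),\qquad \phi'(f)=J\phi(f^*)J,\qquad f^*(x)=\overline{f(-x)}.$$ Let $W_R=\{x\in\mathbb R^2: x_1>|x_0|\}$ and $W_L=-W_R$, and for $W\in\{W_R,W_L\}$ let $\mathcal S(W)$ be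 the set of $f\in\mathcal S(\mathbb R^2)$ that vanish outside $W$. Then $\phi$ and $\phi'$ are relatively wedge-local: for all $f\in\mathcal S(W_R)$ and $g\in\mathcal S(W_L)$, $$[\phi'(f),\phi(g)]\Psi=0\qquad\text{for all }\Psi\in\mathcal D .$$ -/

import Mathlib

open MeasureTheory
open scoped ComplexConjugate ENNReal SchwartzMap

namespace WedgeLocal

noncomputable section

/-! ## Scattering functions -/

/-- The open strip `S(0,π) = {ζ : 0 < Im ζ < π}`. -/
def strip : Set ℂ := {ζ | 0 < ζ.im ∧ ζ.im < Real.pi}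

/-- The closed strip `{ζ : 0 ≤ Im ζ ≤ π}`. -/
def closedStrip : Set ℂ := {ζ | 0 ≤ ζ.im ∧ ζ.im ≤ Real.pi}

/-- A scattering function: analytic on the open strip `S(0,π)`, bounded and continuous on its
closure, with `conj (S₂ θ) = (S₂ θ)⁻¹ = S₂ (-θ) = S₂ (θ + iπ)` for real `θ`.
Only the values on the closed strip are meaningful. The field `ne_zero` says that the inverse
in these relations exists (needed because of the convention `0⁻¹ = 0`). -/
structure ScatteringFunction where
  toFun : ℂ → ℂ
  analytic : AnalyticOnNhd ℂ toFun strip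
  continuousOn : ContinuousOn toFun closedStrip
  bounded : ∃ C : ℝ, ∀ ζ ∈ closedStrip, ‖toFun ζ‖ ≤ C
  ne_zero : ∀ θ : ℝ, toFun θ ≠ 0
  conj_eq_inv : ∀ θ : ℝ, conj (toFun θ) = (toFun θ)⁻¹
  inv_eq_neg : ∀ θ : ℝ, (toFun θ)⁻¹ = toFun (-θ)
  neg_eq_crossing : ∀ θ : ℝ, toFun (-θ) = toFun (θ + Real.pi * Complex.I)

namespace ScatteringFunction

variable (S : ScatteringFunction)

/-- The boundary values of the scattering function on the real line. -/
def onReal (θ : ℝ) : ℂ := S.toFun θ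

lemma norm_onReal (θ : ℝ) : ‖S.onReal θ‖ = 1 := by
  have h1 := S.conj_eq_inv θ
  have h2 : conj (S.toFun θ) * S.toFun θ = 1 := by
    rw [h1, inv_mul_cancel₀ (S.ne_zero θ)]
  have h3 := congrArg norm h2
  rw [norm_mul, RCLike.norm_conj, norm_one] at h3
  have h4 : (0 : ℝ) ≤ ‖S.toFun θ‖ := norm_nonneg _
  show ‖S.toFun θ‖ = 1
  nlinarith

lemma continuous_onReal : Continuous S.onReal := by
  apply S.continuousOn.comp_continuous Complex.continuous_ofReal
  intro θ
  exact ⟨by simp, by simpa using Real.pi_pos.le⟩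

lemma conj_onReal (θ : ℝ) : conj (S.onReal θ) = S.onReal (-θ) := by
  simp only [onReal, Complex.ofReal_neg]
  rw [S.conj_eq_inv, S.inv_eq_neg]

end ScatteringFunction

/-! ## The unsymmetrized Fock space -/

/-- The one-particle space `L²(ℝ, dθ)`. -/
abbrev H1 : Type := Lp ℂ 2 (volume : Measure ℝ)

/-- The unsymmetrized `n`-particle space `L²(ℝⁿ)`; for `n = 0` this is a copy of `ℂ`. -/
abbrev L2 (n : ℕ) : Type := Lp ℂ 2 (volume : Measure (Fin n → ℝ))

/-- The unsymmetrized Fock space, the Hilbert space sum of the `L²(ℝⁿ)`. -/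
abbrev Fock : Type := lp L2 2

/-- The vectors of finite particle number in the unsymmetrized Fock space. -/
def finiteFock : Submodule ℂ Fock where
  carrier := {Ψ | ∃ N : ℕ, ∀ n, N ≤ n → Ψ n = 0}
  zero_mem' := ⟨0, fun _ _ => rfl⟩
  add_mem' := by
    rintro Φ Ψ ⟨N, hN⟩ ⟨M, hM⟩
    refine ⟨max N M, fun n hn => ?_⟩
    rw [lp.coeFn_add, Pi.add_apply, hN n (le_of_max_le_left hn), hM n (le_of_max_le_right hn),
      add_zero]
  smul_mem' := by
    rintro c Φ ⟨N, hN⟩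
    refine ⟨N, fun n hn => ?_⟩
    rw [lp.coeFn_smul, Pi.smul_apply, hN n hn, smul_zero]

lemma memlp_of_finite (Φ : ∀ n, L2 n) (h : ∃ N : ℕ, ∀ n, N ≤ n → Φ n = 0) : Memℓp Φ 2 := by
  obtain ⟨N, hN⟩ := h
  refine (memℓp_zero ((Set.finite_lt_nat N).subset ?_)).of_exponent_ge zero_le
  intro n hn
  by_contra hlt
  exact hn (hN n (not_lt.1 hlt))

/-- The vector with given components, all but finitely many of which vanish. -/
def mkFinite (Φ : ∀ n, L2 n) (h : ∃ N : ℕ, ∀ n, N ≤ n → Φ n = 0) : finiteFock :=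
  ⟨⟨Φ, memlp_of_finite Φ h⟩, h⟩

lemma mkFinite_apply (Φ : ∀ n, L2 n) (h) (n : ℕ) : (mkFinite Φ h : Fock) n = Φ n := rfl

lemma finiteFock_ext {Φ Ψ : finiteFock} (h : ∀ n, (Φ : Fock) n = (Ψ : Fock) n) : Φ = Ψ :=
  Subtype.ext (lp.ext (funext h))

/-! ## The `S₂`-symmetrization -/

lemma measurePreserving_perm {n : ℕ} (π : Equiv.Perm (Fin n)) :
    MeasurePreserving (fun θ : Fin n → ℝ => θ ∘ π) volume volume :=
  volume_preserving_arrowCongr' π.symm (MeasurableEquiv.refl ℝ) (MeasurePreserving.id _)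

/-- The factor
`S^π(θ) = ∏_{l < k, π(l) > π(k)} S₂(θ_{π(l)} - θ_{π(k)})`. -/
def permFactor (S : ScatteringFunction) {n : ℕ} (π : Equiv.Perm (Fin n)) (θ : Fin n → ℝ) : ℂ :=
  ∏ q : Fin n × Fin n with q.1 < q.2 ∧ π q.2 < π q.1, S.onReal (θ (π q.1) - θ (π q.2))

lemma continuous_permFactor (S : ScatteringFunction) {n : ℕ} (π : Equiv.Perm (Fin n)) :
    Continuous (permFactor S π) := by
  refine continuous_finsetProd _ fun q _ => S.continuous_onReal.comp ?_
  fun_prop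

lemma norm_permFactor (S : ScatteringFunction) {n : ℕ} (π : Equiv.Perm (Fin n))
    (θ : Fin n → ℝ) : ‖permFactor S π θ‖ = 1 := by
  rw [permFactor, norm_prod]
  exact Finset.prod_eq_one fun q _ => S.norm_onReal _

lemma memLp_perm (S : ScatteringFunction) {n : ℕ} (π : Equiv.Perm (Fin n)) (Φ : L2 n) :
    MemLp (fun θ : Fin n → ℝ => permFactor S π θ * Φ (θ ∘ π)) 2 volume := by
  have h1 : MemLp (fun θ : Fin n → ℝ => Φ (θ ∘ π)) 2 volume :=
    (Lp.memLp Φ).comp_measurePreserving (measurePreserving_perm π)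
  refine h1.of_le ((continuous_permFactor S π).aestronglyMeasurable.mul h1.1)
    (Filter.Eventually.of_forall fun θ => ?_)
  rw [norm_mul, norm_permFactor, one_mul]

/-- The operator `(D_n(π) Φ)(θ) = S^π(θ) Φ(θ_{π(1)}, …, θ_{π(n)})` on `L²(ℝⁿ)`. -/
def permOp (S : ScatteringFunction) {n : ℕ} (π : Equiv.Perm (Fin n)) : L2 n →ₗ[ℂ] L2 n where
  toFun Φ := (memLp_perm S π Φ).toLp _
  map_add' Φ Ψ := by
    rw [← MemLp.toLp_add, MemLp.toLp_eq_toLp_iff]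
    filter_upwards [(measurePreserving_perm π).quasiMeasurePreserving.ae (Lp.coeFn_add Φ Ψ)]
      with θ hθ
    simp only [Pi.add_apply] at hθ ⊢
    rw [hθ, mul_add]
  map_smul' c Φ := by
    rw [RingHom.id_apply, ← MemLp.toLp_const_smul, MemLp.toLp_eq_toLp_iff]
    filter_upwards [(measurePreserving_perm π).quasiMeasurePreserving.ae (Lp.coeFn_smul c Φ)]
      with θ hθ
    simp only [Pi.smul_apply, smul_eq_mul] at hθ ⊢
    rw [hθ]
    ring

lemma permOp_coeFn (S : ScatteringFunction) {n : ℕ} (π : Equiv.Perm (Fin n)) (Φ : L2 n) :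
    permOp S π Φ =ᵐ[volume] fun θ => permFactor S π θ * Φ (θ ∘ π) :=
  MemLp.coeFn_toLp (memLp_perm S π Φ)

/-- `P_n = (1/n!) ∑_π D_n(π)`. -/
def symProj (S : ScatteringFunction) (n : ℕ) : L2 n →ₗ[ℂ] L2 n :=
  ((n.factorial : ℂ)⁻¹) • ∑ π : Equiv.Perm (Fin n), permOp S π

/-- The `n`-particle space `H_n = P_n L²(ℝⁿ)`. -/
def nParticle (S : ScatteringFunction) (n : ℕ) : Submodule ℂ (L2 n) :=
  LinearMap.range (symProj S n)

/-- The `S₂`-symmetric Fock space, the Hilbert space sum of the `H_n`, as a subspace of the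
unsymmetrized Fock space. -/
def hilbert (S : ScatteringFunction) : Submodule ℂ Fock where
  carrier := {Ψ | ∀ n, Ψ n ∈ nParticle S n}
  zero_mem' := fun n => (nParticle S n).zero_mem
  add_mem' := fun hΦ hΨ n => (nParticle S n).add_mem (hΦ n) (hΨ n)
  smul_mem' := fun c _ hΦ n => (nParticle S n).smul_mem c (hΦ n)

/-- The space `𝒟` of vectors of finite particle number in the `S₂`-symmetric Fock space. -/
def domain (S : ScatteringFunction) : Submodule ℂ Fock := hilbert S ⊓ finiteFock

/-- The inclusion of `𝒟` into the finite particle vectors of the unsymmetrized Fock space. -/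
def incl (S : ScatteringFunction) : domain S →ₗ[ℂ] finiteFock :=
  Submodule.inclusion inf_le_right

/-- The projection `P = ⨁ P_n`, on vectors of finite particle number. -/
def fockProj (S : ScatteringFunction) : finiteFock →ₗ[ℂ] domain S where
  toFun Φ :=
    ⟨mkFinite (fun n => symProj S n ((Φ : Fock) n))
      (Φ.2.imp fun N hN n hn => by rw [hN n hn, map_zero]),
      fun n => ⟨(Φ : Fock) n, rfl⟩, (mkFinite _ _).2⟩
  map_add' Φ Ψ := Subtype.ext <| lp.ext <| funext fun n =>
    map_add (symProj S n) ((Φ : Fock) n) ((Ψ : Fock) n)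
  map_smul' c Φ := Subtype.ext <| lp.ext <| funext fun n =>
    map_smul (symProj S n) c ((Φ : Fock) n)

/-! ## Creation and annihilation operators -/

lemma measurePreserving_cons (n : ℕ) :
    MeasurePreserving (fun q : ℝ × (Fin n → ℝ) => (Fin.cons q.1 q.2 : Fin (n + 1) → ℝ))
      volume volume := by
  have h := (volume_preserving_piFinSuccAbove (fun _ : Fin (n + 1) => ℝ) 0).symm
  have e : (fun q : ℝ × (Fin n → ℝ) => (Fin.cons q.1 q.2 : Fin (n + 1) → ℝ)) =
      (MeasurableEquiv.piFinSuccAbove (fun _ : Fin (n + 1) => ℝ) 0).symm := by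
    funext q
    exact (Fin.insertNth_zero' q.1 q.2).symm
  rw [e]
  exact h

lemma measurePreserving_uncons (n : ℕ) :
    MeasurePreserving (fun θ : Fin (n + 1) → ℝ => (θ 0, Fin.tail θ)) volume volume :=
  volume_preserving_piFinSuccAbove (fun _ : Fin (n + 1) => ℝ) 0

lemma memLp_comp_cons {n : ℕ} (Φ : L2 (n + 1)) :
    MemLp (fun q : ℝ × (Fin n → ℝ) => Φ (Fin.cons q.1 q.2)) 2 (volume.prod volume) :=
  (Lp.memLp Φ).comp_measurePreserving (measurePreserving_cons n)

lemma memLp_slice {n : ℕ} (Φ : L2 (n + 1)) :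
    ∀ᵐ θ : Fin n → ℝ, MemLp (fun s : ℝ => Φ (Fin.cons s θ)) 2 volume := by
  have hG := memLp_comp_cons Φ
  have hG2 := (memLp_two_iff_integrable_sq_norm hG.1).1 hG
  have hm : ∀ᵐ θ : Fin n → ℝ, AEStronglyMeasurable (fun s : ℝ => Φ (Fin.cons s θ)) volume :=
    hG.1.prodMk_right
  filter_upwards [hG2.prod_left_ae, hm] with θ h1 h2
  exact (memLp_two_iff_integrable_sq_norm h2).2 h1

lemma integrable_slice {n : ℕ} (ψ : H1) (Φ : L2 (n + 1)) :
    ∀ᵐ θ : Fin n → ℝ, Integrable (fun s : ℝ => ψ s * Φ (Fin.cons s θ)) := by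
  filter_upwards [memLp_slice Φ] with θ h
  exact (Lp.memLp ψ).integrable_mul h

lemma sq_norm_integral_mul_le {f g : ℝ → ℂ} (hf : MemLp f 2 volume) (hg : MemLp g 2 volume) :
    ‖∫ s, f s * g s‖ ^ 2 ≤ (∫ s, ‖f s‖ ^ 2) * ∫ s, ‖g s‖ ^ 2 := by
  have h0 : ‖∫ s, f s * g s‖ ≤ ∫ s, ‖f s‖ * ‖g s‖ := by
    refine (norm_integral_le_integral_norm _).trans (le_of_eq ?_)
    simp only [norm_mul]
  have hpq : Real.HolderConjugate 2 2 := Real.HolderConjugate.two_two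
  have h1 := integral_mul_norm_le_Lp_mul_Lq hpq (μ := volume) (f := f) (g := g)
    (by simpa using hf) (by simpa using hg)
  have hA : (0 : ℝ) ≤ ∫ s, ‖f s‖ ^ 2 := integral_nonneg fun s => by positivity
  have hB : (0 : ℝ) ≤ ∫ s, ‖g s‖ ^ 2 := integral_nonneg fun s => by positivity
  simp only [Real.rpow_ofNat, ← Real.sqrt_eq_rpow] at h1
  have h2 := h0.trans h1
  calc ‖∫ s, f s * g s‖ ^ 2
      ≤ (Real.sqrt (∫ s, ‖f s‖ ^ 2) * Real.sqrt (∫ s, ‖g s‖ ^ 2)) ^ 2 :=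
        pow_le_pow_left₀ (norm_nonneg _) h2 2
    _ = _ := by rw [mul_pow, Real.sq_sqrt hA, Real.sq_sqrt hB]

lemma memLp_annihilate {n : ℕ} (ψ : H1) (Φ : L2 (n + 1)) :
    MemLp (fun θ : Fin n → ℝ => ((Real.sqrt (n + 1) : ℝ) : ℂ) *
      ∫ s : ℝ, ψ s * Φ (Fin.cons s θ)) 2 volume := by
  refine MemLp.const_mul ?_ _
  have hG := memLp_comp_cons Φ
  have hG2 := (memLp_two_iff_integrable_sq_norm hG.1).1 hG
  have hψ : AEStronglyMeasurable (fun q : ℝ × (Fin n → ℝ) => ψ q.1) (volume.prod volume) :=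
    (Lp.memLp ψ).1.comp_fst
  have hmeas : AEStronglyMeasurable
      (fun θ : Fin n → ℝ => ∫ s : ℝ, ψ s * Φ (Fin.cons s θ)) volume :=
    (hψ.mul hG.1).prod_swap.integral_prod_right'
  rw [memLp_two_iff_integrable_sq_norm hmeas]
  refine Integrable.mono' (hG2.integral_prod_right.const_mul (∫ s, ‖ψ s‖ ^ 2))
    (hmeas.norm.pow 2) ?_
  filter_upwards [memLp_slice Φ] with θ h
  rw [Real.norm_of_nonneg (by positivity)]
  exact sq_norm_integral_mul_le (Lp.memLp ψ) h

/-- The annihilation operator from `n + 1` to `n` particles,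
`(a(ψ) Φ)(θ₁, …, θ_n) = √(n+1) ∫ ψ(θ) Φ(θ, θ₁, …, θ_n) dθ`. -/
def annihilateComp (ψ : H1) (n : ℕ) : L2 (n + 1) →ₗ[ℂ] L2 n where
  toFun Φ := (memLp_annihilate ψ Φ).toLp _
  map_add' Φ Ψ := by
    rw [← MemLp.toLp_add, MemLp.toLp_eq_toLp_iff]
    have h := Measure.ae_ae_of_ae_prod (((measurePreserving_cons n).comp
      Measure.measurePreserving_swap).quasiMeasurePreserving.ae (Lp.coeFn_add Φ Ψ))
    filter_upwards [h, integrable_slice ψ Φ, integrable_slice ψ Ψ] with θ hθ h1 h2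
    simp only [Pi.add_apply]
    rw [← mul_add, ← integral_add h1 h2]
    congr 1
    refine integral_congr_ae ?_
    filter_upwards [hθ] with s hs
    simp only [Function.comp_apply, Prod.swap, Pi.add_apply] at hs
    rw [hs, mul_add]
  map_smul' c Φ := by
    rw [RingHom.id_apply, ← MemLp.toLp_const_smul, MemLp.toLp_eq_toLp_iff]
    have h := Measure.ae_ae_of_ae_prod (((measurePreserving_cons n).comp
      Measure.measurePreserving_swap).quasiMeasurePreserving.ae (Lp.coeFn_smul c Φ))
    filter_upwards [h] with θ hθ
    simp only [Pi.smul_apply, smul_eq_mul]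
    rw [mul_left_comm, ← integral_const_mul c]
    refine congrArg _ (integral_congr_ae ?_)
    filter_upwards [hθ] with s hs
    simp only [Function.comp_apply, Prod.swap, Pi.smul_apply, smul_eq_mul] at hs
    rw [hs]
    ring

lemma annihilateComp_coeFn (ψ : H1) (n : ℕ) (Φ : L2 (n + 1)) :
    annihilateComp ψ n Φ =ᵐ[volume] fun θ : Fin n → ℝ =>
      ((Real.sqrt (n + 1) : ℝ) : ℂ) * ∫ s : ℝ, ψ s * Φ (Fin.cons s θ) :=
  MemLp.coeFn_toLp (memLp_annihilate ψ Φ)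

lemma memLp_create {n : ℕ} (ψ : H1) (Φ : L2 n) :
    MemLp (fun θ : Fin (n + 1) → ℝ => ((Real.sqrt (n + 1) : ℝ) : ℂ) *
      (ψ (θ 0) * Φ (Fin.tail θ))) 2 volume := by
  refine MemLp.const_mul ?_ _
  have h1 : MemLp (fun q : ℝ × (Fin n → ℝ) => ψ q.1 * Φ q.2) 2 (volume.prod volume) := by
    have hm : AEStronglyMeasurable (fun q : ℝ × (Fin n → ℝ) => ψ q.1 * Φ q.2)
        (volume.prod volume) := (Lp.memLp ψ).1.comp_fst.mul (Lp.memLp Φ).1.comp_snd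
    rw [memLp_two_iff_integrable_sq_norm hm]
    simp only [norm_mul, mul_pow]
    exact ((memLp_two_iff_integrable_sq_norm (Lp.memLp ψ).1).1 (Lp.memLp ψ)).mul_prod
      ((memLp_two_iff_integrable_sq_norm (Lp.memLp Φ).1).1 (Lp.memLp Φ))
  exact h1.comp_measurePreserving (measurePreserving_uncons n)

/-- The creation operator from `n` to `n + 1` particles,
`(a†(ψ) Φ)(θ₁, …, θ_{n+1}) = √(n+1) ψ(θ₁) Φ(θ₂, …, θ_{n+1})`. -/
def createComp (ψ : H1) (n : ℕ) : L2 n →ₗ[ℂ] L2 (n + 1) where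
  toFun Φ := (memLp_create ψ Φ).toLp _
  map_add' Φ Ψ := by
    rw [← MemLp.toLp_add, MemLp.toLp_eq_toLp_iff]
    filter_upwards [(measurePreserving_uncons n).quasiMeasurePreserving.ae
      (Measure.quasiMeasurePreserving_snd.ae (Lp.coeFn_add Φ Ψ))] with θ hθ
    simp only [Pi.add_apply] at hθ ⊢
    rw [hθ]
    ring
  map_smul' c Φ := by
    rw [RingHom.id_apply, ← MemLp.toLp_const_smul, MemLp.toLp_eq_toLp_iff]
    filter_upwards [(measurePreserving_uncons n).quasiMeasurePreserving.ae
      (Measure.quasiMeasurePreserving_snd.ae (Lp.coeFn_smul c Φ))] with θ hθ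
    simp only [Pi.smul_apply, smul_eq_mul] at hθ ⊢
    rw [hθ]
    ring

lemma createComp_coeFn (ψ : H1) (n : ℕ) (Φ : L2 n) :
    createComp ψ n Φ =ᵐ[volume] fun θ : Fin (n + 1) → ℝ =>
      ((Real.sqrt (n + 1) : ℝ) : ℂ) * (ψ (θ 0) * Φ (Fin.tail θ)) :=
  MemLp.coeFn_toLp (memLp_create ψ Φ)

/-- The unsymmetrized annihilation operator `a(ψ)` on vectors of finite particle number. -/
def annihilate (ψ : H1) : finiteFock →ₗ[ℂ] finiteFock where
  toFun Φ := mkFinite (fun n => annihilateComp ψ n ((Φ : Fock) (n + 1)))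
    (Φ.2.imp fun N hN n hn => by rw [hN (n + 1) (by omega), map_zero])
  map_add' Φ Ψ := finiteFock_ext fun n =>
    map_add (annihilateComp ψ n) ((Φ : Fock) (n + 1)) ((Ψ : Fock) (n + 1))
  map_smul' c Φ := finiteFock_ext fun n =>
    map_smul (annihilateComp ψ n) c ((Φ : Fock) (n + 1))

/-- The components of `a†(ψ) Φ`. -/
def createFun (ψ : H1) (Φ : ∀ n, L2 n) : ∀ n, L2 n
  | 0 => 0
  | n + 1 => createComp ψ n (Φ n)

/-- The unsymmetrized creation operator `a†(ψ)` on vectors of finite particle number. -/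
def create (ψ : H1) : finiteFock →ₗ[ℂ] finiteFock where
  toFun Φ := mkFinite (createFun ψ (Φ : Fock)) (by
    obtain ⟨N, hN⟩ := Φ.2
    refine ⟨N + 1, fun n hn => ?_⟩
    obtain ⟨k, rfl⟩ : ∃ k, n = k + 1 := ⟨n - 1, by omega⟩
    rw [createFun, hN k (by omega), map_zero])
  map_add' Φ Ψ := finiteFock_ext fun n => by
    cases n with
    | zero => exact (add_zero (0 : L2 0)).symm
    | succ n => exact map_add (createComp ψ n) ((Φ : Fock) n) ((Ψ : Fock) n)
  map_smul' c Φ := finiteFock_ext fun n => by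
    cases n with
    | zero => exact (smul_zero c : c • (0 : L2 0) = 0).symm
    | succ n => exact map_smul (createComp ψ n) c ((Φ : Fock) n)

/-- The Zamolodchikov-Faddeev annihilation operator `z(ψ) = P a(ψ) P` on `𝒟`. -/
def zAnn (S : ScatteringFunction) (ψ : H1) : domain S →ₗ[ℂ] domain S :=
  fockProj S ∘ₗ annihilate ψ ∘ₗ incl S ∘ₗ fockProj S ∘ₗ incl S

/-- The Zamolodchikov-Faddeev creation operator `z†(ψ) = P a†(ψ) P` on `𝒟`. -/
def zCre (S : ScatteringFunction) (ψ : H1) : domain S →ₗ[ℂ] domain S :=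
  fockProj S ∘ₗ create ψ ∘ₗ incl S ∘ₗ fockProj S ∘ₗ incl S

/-! ## The reflection `J` -/

lemma memLp_reflect {n : ℕ} (Φ : L2 n) :
    MemLp (fun θ : Fin n → ℝ => conj (Φ (θ ∘ Fin.rev))) 2 volume :=
  ((Lp.memLp Φ).comp_measurePreserving (measurePreserving_perm Fin.revPerm)).star

/-- `(J Φ)(θ₁, …, θ_n) = conj (Φ(θ_n, …, θ₁))` on `L²(ℝⁿ)`, an antilinear map. -/
def reflectComp (n : ℕ) : L2 n →ₛₗ[starRingEnd ℂ] L2 n where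
  toFun Φ := (memLp_reflect Φ).toLp _
  map_add' Φ Ψ := by
    rw [← MemLp.toLp_add, MemLp.toLp_eq_toLp_iff]
    filter_upwards [(measurePreserving_perm (Fin.revPerm (n := n))).quasiMeasurePreserving.ae
      (Lp.coeFn_add Φ Ψ)] with θ hθ
    simp only [Pi.add_apply] at hθ ⊢
    rw [← map_add]
    exact congrArg _ hθ
  map_smul' c Φ := by
    rw [← MemLp.toLp_const_smul, MemLp.toLp_eq_toLp_iff]
    filter_upwards [(measurePreserving_perm (Fin.revPerm (n := n))).quasiMeasurePreserving.ae
      (Lp.coeFn_smul c Φ)] with θ hθ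
    simp only [Pi.smul_apply, smul_eq_mul] at hθ ⊢
    rw [← map_mul]
    exact congrArg _ hθ

lemma reflectComp_coeFn (n : ℕ) (Φ : L2 n) :
    reflectComp n Φ =ᵐ[volume] fun θ : Fin n → ℝ => conj (Φ (θ ∘ Fin.rev)) :=
  MemLp.coeFn_toLp (memLp_reflect Φ)

lemma conj_permFactor_rev (S : ScatteringFunction) {n : ℕ} (π : Equiv.Perm (Fin n))
    (θ : Fin n → ℝ) :
    conj (permFactor S π (θ ∘ Fin.rev)) =
      permFactor S (Fin.revPerm * π * Fin.revPerm) θ := by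
  simp only [permFactor, map_prod, S.conj_onReal]
  refine Finset.prod_bij' (fun q _ => (Fin.rev q.2, Fin.rev q.1))
    (fun q _ => (Fin.rev q.2, Fin.rev q.1)) ?_ ?_ ?_ ?_ ?_
  · simp
  · simp
  · simp
  · simp
  · simp

lemma reflectComp_permOp (S : ScatteringFunction) {n : ℕ} (π : Equiv.Perm (Fin n))
    (Φ : L2 n) :
    reflectComp n (permOp S π Φ) =
      permOp S (Fin.revPerm * π * Fin.revPerm) (reflectComp n Φ) := by
  refine Lp.ext ?_
  have hrev := (measurePreserving_perm (Fin.revPerm (n := n))).quasiMeasurePreserving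
  have hπ := (measurePreserving_perm
    (Fin.revPerm * π * Fin.revPerm : Equiv.Perm (Fin n))).quasiMeasurePreserving
  filter_upwards [reflectComp_coeFn n (permOp S π Φ), hrev.ae (permOp_coeFn S π Φ),
    permOp_coeFn S (Fin.revPerm * π * Fin.revPerm) (reflectComp n Φ),
    hπ.ae (reflectComp_coeFn n Φ)] with θ h1 h2 h3 h4
  rw [h1, h3, h4]
  refine (congrArg conj h2).trans ?_
  rw [map_mul]
  congr 1
  · exact conj_permFactor_rev S π θ
  · congr 2
    funext i
    simp

lemma reflectComp_mem (S : ScatteringFunction) {n : ℕ} {Φ : L2 n} (h : Φ ∈ nParticle S n) :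
    reflectComp n Φ ∈ nParticle S n := by
  obtain ⟨Ψ, rfl⟩ := h
  refine ⟨reflectComp n Ψ, ?_⟩
  simp only [symProj, LinearMap.smul_apply, LinearMap.sum_apply]
  rw [LinearMap.map_smulₛₗ, map_sum, map_inv₀, Complex.conj_natCast]
  congr 1
  simp only [reflectComp_permOp]
  refine (Fintype.sum_equiv ((Equiv.mulLeft Fin.revPerm).trans (Equiv.mulRight Fin.revPerm))
    _ _ fun π => ?_).symm
  simp

/-- The antilinear involution `(J Ψ)_n(θ₁, …, θ_n) = conj (Ψ_n(θ_n, …, θ₁))` on `𝒟`. -/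
def J (S : ScatteringFunction) : domain S →ₛₗ[starRingEnd ℂ] domain S where
  toFun Φ :=
    ⟨mkFinite (fun n => reflectComp n ((Φ : Fock) n))
      (Φ.2.2.imp fun N hN n hn => by rw [hN n hn, map_zero]),
      fun n => reflectComp_mem S (Φ.2.1 n), (mkFinite _ _).2⟩
  map_add' Φ Ψ := Subtype.ext <| lp.ext <| funext fun n =>
    map_add (reflectComp n) ((Φ : Fock) n) ((Ψ : Fock) n)
  map_smul' c Φ := Subtype.ext <| lp.ext <| funext fun n =>
    LinearMap.map_smulₛₗ (reflectComp n) c ((Φ : Fock) n)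

/-! ## Test functions and fields -/

/-- Two-dimensional spacetime, with coordinates `(x₀, x₁) = (x 0, x 1)`. -/
abbrev Spacetime : Type := EuclideanSpace ℝ (Fin 2)

/-- The right wedge `W_R = {x : x₁ > |x₀|}`. -/
def rightWedge : Set Spacetime := {x | |x 0| < x 1}

/-- The left wedge `W_L = -W_R`. -/
def leftWedge : Set Spacetime := {x | -x ∈ rightWedge}

/-- The on-shell momentum `p(θ) = m (cosh θ, sinh θ)`. -/
def momentum (m θ : ℝ) : Spacetime := !₂[m * Real.cosh θ, m * Real.sinh θ]

/-- The Minkowski product `x · y = x₀ y₀ - x₁ y₁`. -/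
def minkowski (x y : Spacetime) : ℝ := x 0 * y 0 - x 1 * y 1

/-- `f⁺(θ) = (1/2π) ∫ f(x) e^{i p(θ)·x} d²x`. -/
def plusFun (m : ℝ) (f : 𝓢(Spacetime, ℂ)) (θ : ℝ) : ℂ :=
  (1 / (2 * Real.pi) : ℂ) * ∫ x, f x * Complex.exp (Complex.I * minkowski (momentum m θ) x)

/-- `f⁻(θ) = (1/2π) ∫ f(-x) e^{i p(θ)·x} d²x`. -/
def minusFun (m : ℝ) (f : 𝓢(Spacetime, ℂ)) (θ : ℝ) : ℂ :=
  (1 / (2 * Real.pi) : ℂ) * ∫ x, f (-x) * Complex.exp (Complex.I * minkowski (momentum m θ) x)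

open FourierTransform in
lemma memLp_plusFun {m : ℝ} (hm : 0 < m) (f : 𝓢(Spacetime, ℂ)) :
    MemLp (plusFun m f) 2 volume := by
  set ξ : ℝ → Spacetime := fun θ =>
    !₂[-(m * Real.cosh θ) / (2 * Real.pi), m * Real.sinh θ / (2 * Real.pi)] with hξ
  have hcont : Continuous ξ := by
    refine (PiLp.continuous_toLp 2 _).comp (continuous_pi fun i => ?_)
    fin_cases i
    · exact (continuous_const.mul Real.continuous_cosh).neg.div_const _
    · exact (continuous_const.mul Real.continuous_sinh).div_const _
  have heq : plusFun m f = fun θ => (1 / (2 * Real.pi) : ℂ) * 𝓕 f (ξ θ) := by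
    funext θ
    rw [plusFun, SchwartzMap.fourier_coe, Real.fourier_eq']
    congr 1
    refine integral_congr_ae (Filter.Eventually.of_forall fun x => ?_)
    simp only [smul_eq_mul]
    rw [mul_comm]
    congr 2
    rw [mul_comm]
    congr 2
    simp only [PiLp.inner_apply, Fin.sum_univ_two, minkowski, momentum, hξ]
    simp
    field_simp
    ring
  rw [heq]
  refine MemLp.const_mul ?_ _
  have hc2 : Continuous fun θ => 𝓕 f (ξ θ) := (𝓕 f).continuous.comp hcont
  rw [memLp_two_iff_integrable_sq_norm hc2.aestronglyMeasurable]
  obtain ⟨C, -, hC⟩ := (𝓕 f).decay 1 0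
  simp only [pow_one, norm_iteratedFDeriv_zero] at hC
  refine Integrable.mono' (integrable_inv_one_add_sq.const_mul ((C * (2 * Real.pi) / m) ^ 2))
    (hc2.norm.pow 2).aestronglyMeasurable (Filter.Eventually.of_forall fun θ => ?_)
  have hpi := Real.pi_pos
  have hch := Real.cosh_pos θ
  have h1 : m * Real.cosh θ / (2 * Real.pi) ≤ ‖ξ θ‖ := by
    have h := PiLp.norm_apply_le (ξ θ) 0
    refine le_trans (le_of_eq ?_) h
    simp only [hξ]
    simp [abs_of_pos hpi, abs_of_pos hm, abs_of_pos hch]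
  have h2 : m * Real.cosh θ / (2 * Real.pi) * ‖𝓕 f (ξ θ)‖ ≤ C :=
    (mul_le_mul_of_nonneg_right h1 (norm_nonneg _)).trans (hC (ξ θ))
  have h3 : Real.cosh θ * ‖𝓕 f (ξ θ)‖ ≤ C * (2 * Real.pi) / m := by
    rw [le_div_iff₀ hm]
    have := mul_le_mul_of_nonneg_right h2 (by positivity : 0 ≤ 2 * Real.pi)
    refine le_trans (le_of_eq ?_) this
    field_simp
  have h4 : (Real.cosh θ * ‖𝓕 f (ξ θ)‖) ^ 2 ≤ (C * (2 * Real.pi) / m) ^ 2 :=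
    pow_le_pow_left₀ (by positivity) h3 2
  have h5 : 1 + θ ^ 2 ≤ Real.cosh θ ^ 2 := by
    have h6 : |θ| ≤ |Real.sinh θ| := by
      rw [Real.abs_sinh]
      exact Real.self_le_sinh_iff.2 (abs_nonneg θ)
    have h7 := sq_le_sq.2 h6
    rw [Real.cosh_sq]
    linarith
  rw [Real.norm_of_nonneg (by positivity), ← div_eq_mul_inv, le_div_iff₀ (by positivity)]
  calc ‖𝓕 f (ξ θ)‖ ^ 2 * (1 + θ ^ 2) ≤ ‖𝓕 f (ξ θ)‖ ^ 2 * Real.cosh θ ^ 2 := by gcongr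
    _ = (Real.cosh θ * ‖𝓕 f (ξ θ)‖) ^ 2 := by ring
    _ ≤ _ := h4

/-- The reflected test function `x ↦ f(-x)`. -/
def negTest (f : 𝓢(Spacetime, ℂ)) : 𝓢(Spacetime, ℂ) :=
  SchwartzMap.compCLMOfContinuousLinearEquiv ℂ (ContinuousLinearEquiv.neg ℝ) f

lemma negTest_apply (f : 𝓢(Spacetime, ℂ)) (x : Spacetime) : negTest f x = f (-x) := rfl

lemma memLp_minusFun {m : ℝ} (hm : 0 < m) (f : 𝓢(Spacetime, ℂ)) :
    MemLp (minusFun m f) 2 volume :=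
  memLp_plusFun hm (negTest f)

/-- `f⁺` as a one-particle vector. -/
def plusVec {m : ℝ} (hm : 0 < m) (f : 𝓢(Spacetime, ℂ)) : H1 := (memLp_plusFun hm f).toLp _

/-- `f⁻` as a one-particle vector. -/
def minusVec {m : ℝ} (hm : 0 < m) (f : 𝓢(Spacetime, ℂ)) : H1 := (memLp_minusFun hm f).toLp _

/-- The test function `f*(x) = conj (f(-x))`. -/
def starTest (f : 𝓢(Spacetime, ℂ)) : 𝓢(Spacetime, ℂ) :=
  SchwartzMap.postcompCLM (𝕜 := ℝ) Complex.conjCLE.toContinuousLinearMap (negTest f)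

lemma starTest_apply (f : 𝓢(Spacetime, ℂ)) (x : Spacetime) :
    starTest f x = conj (f (-x)) := rfl

/-- The field operator `φ(f) = z†(f⁺) + z(f⁻)` on `𝒟`. -/
def field (S : ScatteringFunction) {m : ℝ} (hm : 0 < m) (f : 𝓢(Spacetime, ℂ)) :
    Module.End ℂ (domain S) :=
  zCre S (plusVec hm f) + zAnn S (minusVec hm f)

/-- The reflected field operator `φ'(f) = J φ(f*) J` on `𝒟`. -/
def reflectedField (S : ScatteringFunction) {m : ℝ} (hm : 0 < m) (f : 𝓢(Spacetime, ℂ)) :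
    Module.End ℂ (domain S) :=
  (J S).comp ((field S hm (starTest f)).comp (J S))

end

end WedgeLocal

namespace WedgeLocal

noncomputable section

/-! ## The representation property of the `D_n(π)` -/

/-! Conjugation by `J` moves creation and annihilation from the first argument to the last. Thus
`φ'(f)` acts at one end of the list of rapidities and `φ(g)` at the other, and the two interfere
only when a particle created at one end is annihilated at the other.

Algebraic part. The `D_n(π)` form a representation (`permOp_mul`), so `P_n` absorbs permutations.
Hence the projections inside products of creators can be dropped, and annihilators preserve the
symmetric vectors. The two creators commute, and so do the two annihilators. For a mixed pair,
`P_{n+1}` applied to a newly created vector is an average over the position of the new particle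
(`symProj_succ`). The terms where it is not last reassemble into the product in the opposite order.
The term where it is last gives multiplication by an exchange integral containing `∏ S₂(t - θ_j)`,
one factor for each particle passed. Conjugating by `J` gives the other mixed commutator, with `∏
S₂(θ_j - t)`. The commutator of the fields is the difference of the two integrals
(`commutator_eq_zero`).

Analytic part. For `f` supported in the right wedge, `f⁻` and `f⁺` are the boundary values at `Im ζ
= 0` and `Im ζ = π` of one bounded analytic function on the strip, because `e^{-ip(ζ)·x}` is damped
there. The same holds for `x ↦ g(-x)`, with the roles of `g⁺` and `g⁻` exchanged. Crossing symmetry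
turns `S₂(t - θ_j)` into `S₂(θ_j - t)` on the upper line. The two exchange integrals are therefore
integrals of one analytic function over the two edges of the strip, and Cauchy's theorem equates
them (`integral_minusFun_mul_plusFun`). -/

lemma ScatteringFunction.onReal_mul_neg (S : ScatteringFunction) (θ : ℝ) :
    S.onReal θ * S.onReal (-θ) = 1 := by
  rw [← S.conj_onReal, Complex.mul_conj, Complex.normSq_eq_norm_sq, S.norm_onReal]
  simp

/-- Ordered pairs are grouped into unordered ones. This lets the inversions of `π * σ` be compared
with those of `π` and `σ` pair by pair. -/
lemma prod_pairs_eq_prod_lt {ι M : Type*} [Fintype ι] [LinearOrder ι] [CommMonoid M]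
    (A : ι → ι → M) (hA : ∀ i, A i i = 1) :
    ∏ q : ι × ι, A q.1 q.2 = ∏ q : ι × ι with q.1 < q.2, A q.1 q.2 * A q.2 q.1 := by
  have h1 : ∏ q : ι × ι with q.1 < q.2, A q.2 q.1 = ∏ q : ι × ι with ¬ q.1 < q.2, A q.1 q.2 := by
    have h2 : ∏ q : ι × ι with ¬ q.1 < q.2, A q.1 q.2 = ∏ q : ι × ι with q.2 < q.1, A q.1 q.2 := by
      symm
      refine Finset.prod_subset (fun q hq => ?_) fun q hq hq' => ?_
      · simp only [Finset.mem_filter, Finset.mem_univ, true_and] at hq ⊢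
        exact hq.not_gt
      · simp only [Finset.mem_filter, Finset.mem_univ, true_and, not_lt] at hq hq'
        rw [le_antisymm hq hq', hA]
    rw [h2]
    exact Finset.prod_bij' (fun q _ => q.swap) (fun q _ => q.swap) (by simp) (by simp) (by simp)
      (by simp) (by simp)
  rw [Finset.prod_mul_distrib, h1, Finset.prod_filter_mul_prod_filter_not]

lemma permFactor_eq (S : ScatteringFunction) {n : ℕ} (π : Equiv.Perm (Fin n)) (θ : Fin n → ℝ) :
    permFactor S π θ = ∏ q : Fin n × Fin n,
      if q.1 < q.2 ∧ π q.2 < π q.1 then S.onReal (θ (π q.1) - θ (π q.2)) else 1 := by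
  rw [permFactor, Finset.prod_filter]

/-- This cocycle identity is what makes `D_n` a representation. A pair contributes differently to
the two sides only if `σ` inverts it and `π` restores its order; the two factors are then `S₂(x)`
and `S₂(-x)`, whose product is 1. -/
lemma permFactor_mul (S : ScatteringFunction) {n : ℕ} (π σ : Equiv.Perm (Fin n))
    (θ : Fin n → ℝ) :
    permFactor S (π * σ) θ = permFactor S π θ * permFactor S σ (θ ∘ π) := by
  -- Reindexing by `σ` labels the inversions of `π` by the same pairs as those of `π * σ`.
  have h : permFactor S π θ = ∏ q : Fin n × Fin n,
      if σ q.1 < σ q.2 ∧ π (σ q.2) < π (σ q.1) then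
        S.onReal (θ (π (σ q.1)) - θ (π (σ q.2))) else 1 := by
    rw [permFactor_eq]
    exact (Fintype.prod_equiv (σ.prodCongr σ) _ _ fun q => rfl).symm
  rw [h, permFactor_eq, permFactor_eq, ← Finset.prod_mul_distrib]
  rw [prod_pairs_eq_prod_lt (fun i j => if i < j ∧ (π * σ) j < (π * σ) i then
    S.onReal (θ ((π * σ) i) - θ ((π * σ) j)) else 1) (by simp),
    prod_pairs_eq_prod_lt (fun i j => (if σ i < σ j ∧ π (σ j) < π (σ i) then
        S.onReal (θ (π (σ i)) - θ (π (σ j))) else 1) *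
        (if i < j ∧ σ j < σ i then S.onReal ((θ ∘ π) (σ i) - (θ ∘ π) (σ j)) else 1)) (by simp)]
  refine Finset.prod_congr rfl fun q hq => ?_
  obtain ⟨i, j⟩ := q
  simp only [Finset.mem_filter, Finset.mem_univ, true_and] at hq
  have hs : σ i ≠ σ j := fun h => hq.ne (σ.injective h)
  have hp : π (σ i) ≠ π (σ j) := fun h => hs (π.injective h)
  have hu := S.onReal_mul_neg (θ (π (σ i)) - θ (π (σ j)))
  rw [neg_sub] at hu
  rcases hs.lt_or_gt with h1 | h1 <;> rcases hp.lt_or_gt with h2 | h2 <;>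
    simp [hq, hq.not_gt, h1, h1.not_gt, h2, h2.not_gt, hu]

lemma permOp_mul (S : ScatteringFunction) {n : ℕ} (π σ : Equiv.Perm (Fin n)) (Φ : L2 n) :
    permOp S (π * σ) Φ = permOp S π (permOp S σ Φ) := by
  refine Lp.ext ?_
  filter_upwards [permOp_coeFn S (π * σ) Φ, permOp_coeFn S π (permOp S σ Φ),
    (measurePreserving_perm π).quasiMeasurePreserving.ae (permOp_coeFn S σ Φ)] with θ h1 h2 h3
  rw [h1, h2, h3, permFactor_mul, mul_assoc]
  rfl

/-! ### The symmetrizer and its expansion over cosets -/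

lemma symProj_apply (S : ScatteringFunction) {n : ℕ} (Φ : L2 n) :
    symProj S n Φ = ((n.factorial : ℂ)⁻¹) • ∑ π : Equiv.Perm (Fin n), permOp S π Φ := by
  simp [symProj]

lemma symProj_permOp (S : ScatteringFunction) {n : ℕ} (π : Equiv.Perm (Fin n)) (Φ : L2 n) :
    symProj S n (permOp S π Φ) = symProj S n Φ := by
  simp only [symProj_apply, ← permOp_mul]
  congr 1
  exact Fintype.sum_equiv (Equiv.mulRight π) _ _ fun σ => rfl

lemma permOp_symProj (S : ScatteringFunction) {n : ℕ} (π : Equiv.Perm (Fin n)) (Φ : L2 n) :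
    permOp S π (symProj S n Φ) = symProj S n Φ := by
  simp only [symProj_apply, map_smul, map_sum, ← permOp_mul]
  congr 1
  exact Fintype.sum_equiv (Equiv.mulLeft π) _ _ fun σ => rfl

lemma permOp_eq_self (S : ScatteringFunction) {n : ℕ} (π : Equiv.Perm (Fin n)) {Φ : L2 n}
    (h : Φ ∈ nParticle S n) : permOp S π Φ = Φ := by
  obtain ⟨Ψ, rfl⟩ := h
  exact permOp_symProj S π Ψ

lemma symProj_eq_self_of_forall (S : ScatteringFunction) {n : ℕ} {Φ : L2 n}
    (h : ∀ π, permOp S π Φ = Φ) : symProj S n Φ = Φ := by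
  rw [symProj_apply, Finset.sum_congr rfl fun π _ => h π, Finset.sum_const, Finset.card_univ,
    Fintype.card_perm, Fintype.card_fin, ← Nat.cast_smul_eq_nsmul ℂ, smul_smul,
    inv_mul_cancel₀ (Nat.cast_ne_zero.2 n.factorial_ne_zero), one_smul]

lemma symProj_eq_self (S : ScatteringFunction) {n : ℕ} {Φ : L2 n}
    (h : Φ ∈ nParticle S n) : symProj S n Φ = Φ :=
  symProj_eq_self_of_forall S fun π => permOp_eq_self S π h

/-- A function of permutations which only depends on the coset `π S_n`, `S_n` being the stabilizer
of `0`, is summed over coset representatives. -/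
lemma sum_perm_eq_sum_cycleRange {E : Type*} [AddCommGroup E] [Module ℂ E] {n : ℕ}
    (F : Equiv.Perm (Fin (n + 1)) → E)
    (hF : ∀ π σ : Equiv.Perm (Fin (n + 1)), σ 0 = 0 → F (π * σ) = F π) :
    ∑ π, F π = (n.factorial : ℂ) • ∑ k : Fin (n + 1), F k.cycleRange.symm := by
  have h1 : ∀ q : Fin (n + 1) × Equiv.Perm (Fin n),
      F (Equiv.Perm.decomposeFin.symm q) = F q.1.cycleRange.symm := by
    intro q
    -- Both `decomposeFin.symm (k, e)` and `k.cycleRange.symm` send `0` to `k`, so they differ on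
    -- the right by a permutation fixing `0`.
    have h2 : Equiv.Perm.decomposeFin.symm q = q.1.cycleRange.symm *
        (q.1.cycleRange * Equiv.Perm.decomposeFin.symm q) := by
      ext i
      simp
    rw [h2, hF]
    obtain ⟨k, e⟩ := q
    simp
  rw [← Equiv.sum_comp Equiv.Perm.decomposeFin.symm, Finset.sum_congr rfl fun q _ => h1 q,
    Fintype.sum_prod_type, Finset.smul_sum]
  refine Finset.sum_congr rfl fun k _ => ?_
  simp only [Finset.sum_const, Finset.card_univ, Fintype.card_perm, Fintype.card_fin,
    Nat.cast_smul_eq_nsmul]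

/-- A vector already symmetric in all but its first argument needs only one representative per
coset. `k.cycleRange.symm` sends `0` to `k` and keeps the order of the remaining indices, so the sum
runs over the slots the first argument can be moved to. -/
lemma symProj_succ (S : ScatteringFunction) {n : ℕ} (Φ : L2 (n + 1))
    (h : ∀ σ : Equiv.Perm (Fin (n + 1)), σ 0 = 0 → permOp S σ Φ = Φ) :
    symProj S (n + 1) Φ =
      ((n + 1 : ℂ)⁻¹) • ∑ k : Fin (n + 1), permOp S k.cycleRange.symm Φ := by
  rw [symProj_apply, sum_perm_eq_sum_cycleRange (fun π => permOp S π Φ)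
    fun π σ hσ => by rw [permOp_mul, h σ hσ], smul_smul]
  congr 1
  have : (n.factorial : ℂ) ≠ 0 := Nat.cast_ne_zero.2 n.factorial_ne_zero
  have : (n + 1 : ℂ) ≠ 0 := Nat.cast_add_one_ne_zero n
  rw [Nat.factorial_succ]
  push_cast
  field_simp

/-! ### Permutations fixing an end point and their scattering factors -/

lemma exists_perm_fix_zero {n : ℕ} (σ : Equiv.Perm (Fin (n + 1))) (hσ : σ 0 = 0) :
    ∃ e : Equiv.Perm (Fin n), ∀ i, σ i.succ = (e i).succ := by
  obtain ⟨⟨k, e⟩, rfl⟩ := Equiv.Perm.decomposeFin.symm.surjective σ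
  rw [Equiv.Perm.decomposeFin_symm_apply_zero] at hσ
  subst hσ
  exact ⟨e, fun i => by simp⟩

lemma exists_perm_extend {n : ℕ} (e : Equiv.Perm (Fin n)) :
    ∃ σ : Equiv.Perm (Fin (n + 1)), σ (Fin.last n) = Fin.last n ∧
      ∀ i, σ (Fin.castSucc i) = (e i).castSucc := by
  -- `decomposeFin` splits off the index `0`; conjugation by the reversal makes it split off the
  -- last index.
  refine ⟨Fin.revPerm * Equiv.Perm.decomposeFin.symm (0, Fin.revPerm * e * Fin.revPerm) *
    Fin.revPerm, ?_, fun i => ?_⟩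
  · simp
  · simp [Fin.rev_castSucc, Fin.rev_succ]

lemma cycleRange_symm_castSucc_last {n : ℕ} (j : Fin n) :
    j.castSucc.cycleRange.symm (Fin.last n) = Fin.last n := by
  rw [Equiv.symm_apply_eq, Fin.cycleRange_of_gt (Fin.castSucc_lt_last j)]

lemma cycleRange_symm_castSucc_castSucc {n : ℕ} (j i : Fin n) :
    j.castSucc.cycleRange.symm i.castSucc = (j.cycleRange.symm i).castSucc := by
  obtain _ | n := n
  · exact j.elim0
  · refine Fin.cases ?_ (fun i => ?_) i
    · rw [Fin.castSucc_zero, Fin.cycleRange_symm_zero, Fin.cycleRange_symm_zero]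
    · rw [← Fin.succ_castSucc, Fin.cycleRange_symm_succ, Fin.cycleRange_symm_succ,
        Fin.castSucc_succAbove_castSucc]

/-- A fixed end point takes part in no inversion. -/
lemma permFactor_extend_last (S : ScatteringFunction) {n : ℕ} {σ : Equiv.Perm (Fin (n + 1))}
    {e : Equiv.Perm (Fin n)} (h0 : σ (Fin.last n) = Fin.last n)
    (h : ∀ i, σ (Fin.castSucc i) = (e i).castSucc) (θ : Fin (n + 1) → ℝ) :
    permFactor S σ θ = permFactor S e (Fin.init θ) := by
  rw [permFactor_eq, permFactor_eq, Fintype.prod_prod_type, Fintype.prod_prod_type]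
  simp [Fin.prod_univ_castSucc, h0, h, Fin.init, (Fin.le_last _).not_gt]

lemma permFactor_extend_zero (S : ScatteringFunction) {n : ℕ} {σ : Equiv.Perm (Fin (n + 1))}
    {e : Equiv.Perm (Fin n)} (h0 : σ 0 = 0)
    (h : ∀ i : Fin n, σ i.succ = (e i).succ) (θ : Fin (n + 1) → ℝ) :
    permFactor S σ θ = permFactor S e (Fin.tail θ) := by
  rw [permFactor_eq, permFactor_eq, Fintype.prod_prod_type, Fintype.prod_prod_type]
  simp [Fin.prod_univ_succ, h0, h, Fin.tail]

/-- Pulling the last index to the front inverts exactly the pairs containing it: the moved particle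
scatters once with each of the others. -/
lemma permFactor_cycleRange_last (S : ScatteringFunction) {n : ℕ} (θ : Fin (n + 1) → ℝ) :
    permFactor S (Fin.last n).cycleRange.symm θ =
      ∏ j : Fin n, S.onReal (θ (Fin.last n) - θ j.castSucc) := by
  rw [permFactor_eq, Fintype.prod_prod_type, Fin.prod_univ_succ]
  have h : ∏ i : Fin n, ∏ y : Fin (n + 1), (if i.succ < y ∧
      (Fin.last n).cycleRange.symm y < (Fin.last n).cycleRange.symm i.succ then
      S.onReal (θ ((Fin.last n).cycleRange.symm i.succ) - θ ((Fin.last n).cycleRange.symm y))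
      else 1) = 1 := by
    refine Finset.prod_eq_one fun i _ => Finset.prod_eq_one fun y _ => if_neg ?_
    rintro ⟨h1, h2⟩
    obtain ⟨j, rfl⟩ := Fin.exists_succ_eq.2 (Fin.ne_zero_of_lt h1)
    rw [Fin.cycleRange_symm_succ, Fin.cycleRange_symm_succ, Fin.succAbove_last,
      Fin.castSucc_lt_castSucc_iff] at h2
    exact (Fin.succ_lt_succ_iff.1 h1).not_gt h2
  dsimp only
  rw [h, mul_one, Fin.prod_univ_succ, if_neg (by simp), one_mul]
  refine Finset.prod_congr rfl fun j _ => ?_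
  rw [Fin.cycleRange_symm_zero, Fin.cycleRange_symm_succ, Fin.succAbove_last,
    if_pos ⟨Fin.succ_pos j, Fin.castSucc_lt_last j⟩]

lemma comp_cycleRange_last_zero {n : ℕ} (θ : Fin (n + 1) → ℝ) :
    (θ ∘ (Fin.last n).cycleRange.symm) 0 = θ (Fin.last n) := by
  rw [Function.comp_apply, Fin.cycleRange_symm_zero]

lemma tail_comp_cycleRange_last {n : ℕ} (θ : Fin (n + 1) → ℝ) :
    Fin.tail (θ ∘ (Fin.last n).cycleRange.symm) = Fin.init θ := by
  funext i
  rw [Fin.tail, Function.comp_apply, Fin.cycleRange_symm_succ, Fin.succAbove_last, Fin.init]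

/-! ## The reflected creation and annihilation operators -/

lemma measurePreserving_snoc (n : ℕ) :
    MeasurePreserving (fun q : (Fin n → ℝ) × ℝ => (Fin.snoc q.1 q.2 : Fin (n + 1) → ℝ))
      (volume.prod volume) volume := by
  have h := (volume_preserving_piFinSuccAbove (fun _ : Fin (n + 1) => ℝ) (Fin.last n)).symm.comp
    (Measure.measurePreserving_swap (μ := (volume : Measure (Fin n → ℝ))) (ν := (volume : Measure ℝ)))
  have e : (fun q : (Fin n → ℝ) × ℝ => (Fin.snoc q.1 q.2 : Fin (n + 1) → ℝ)) =
      (MeasurableEquiv.piFinSuccAbove (fun _ : Fin (n + 1) => ℝ) (Fin.last n)).symm ∘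
        Prod.swap := by
    funext q
    exact (Fin.insertNth_last' q.2 q.1).symm
  rw [e]
  exact h

lemma measurePreserving_unsnoc (n : ℕ) :
    MeasurePreserving (fun θ : Fin (n + 1) → ℝ => (Fin.init θ, θ (Fin.last n))) volume
      (volume.prod volume) := by
  have h := (Measure.measurePreserving_swap (μ := (volume : Measure ℝ))
      (ν := (volume : Measure (Fin n → ℝ)))).comp
    (volume_preserving_piFinSuccAbove (fun _ : Fin (n + 1) => ℝ) (Fin.last n))
  have e : (fun θ : Fin (n + 1) → ℝ => (Fin.init θ, θ (Fin.last n))) = Prod.swap ∘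
      MeasurableEquiv.piFinSuccAbove (fun _ : Fin (n + 1) => ℝ) (Fin.last n) := by
    funext θ
    refine Prod.ext ?_ rfl
    funext i
    simp [Fin.init, MeasurableEquiv.piFinSuccAbove, Fin.insertNthEquiv]
  rw [e]
  exact h

/-- Elements of `L²` are only classes of functions, so each pointwise formula has to be carried
along slices and coordinate changes as an almost everywhere statement. -/
lemma ae_ae_snoc {n : ℕ} {p : (Fin (n + 1) → ℝ) → Prop} (h : ∀ᵐ θ, p θ) :
    ∀ᵐ θ : Fin n → ℝ, ∀ᵐ t : ℝ, p (Fin.snoc θ t) :=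
  Measure.ae_ae_of_ae_prod ((measurePreserving_snoc n).quasiMeasurePreserving.ae h)

lemma ae_tail {n : ℕ} {p : (Fin n → ℝ) → Prop} (h : ∀ᵐ θ, p θ) :
    ∀ᵐ θ : Fin (n + 1) → ℝ, p (Fin.tail θ) :=
  (measurePreserving_uncons n).quasiMeasurePreserving.ae
    (Measure.quasiMeasurePreserving_snd.ae h)

lemma ae_init {n : ℕ} {p : (Fin n → ℝ) → Prop} (h : ∀ᵐ θ, p θ) :
    ∀ᵐ θ : Fin (n + 1) → ℝ, p (Fin.init θ) :=
  (measurePreserving_unsnoc n).quasiMeasurePreserving.ae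
    (Measure.quasiMeasurePreserving_fst.ae h)

lemma ae_perm {n : ℕ} (π : Equiv.Perm (Fin n)) {p : (Fin n → ℝ) → Prop} (h : ∀ᵐ θ, p θ) :
    ∀ᵐ θ : Fin n → ℝ, p (θ ∘ π) :=
  (measurePreserving_perm π).quasiMeasurePreserving.ae h

lemma ae_rev {n : ℕ} {p : (Fin n → ℝ) → Prop} (h : ∀ᵐ θ, p θ) :
    ∀ᵐ θ : Fin n → ℝ, p (θ ∘ Fin.rev) :=
  ae_perm Fin.revPerm h

lemma reflectComp_reflectComp {n : ℕ} (Φ : L2 n) : reflectComp n (reflectComp n Φ) = Φ := by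
  refine Lp.ext ?_
  filter_upwards [reflectComp_coeFn n (reflectComp n Φ), ae_rev (reflectComp_coeFn n Φ)]
    with θ h1 h2
  rw [h1, h2, Complex.conj_conj]
  congr 1
  funext i
  simp

/-- The operator `J a†(ψ) J`, which creates a particle in the last argument. -/
def reflectedCreate (ψ : H1) (n : ℕ) (Φ : L2 n) : L2 (n + 1) :=
  reflectComp (n + 1) (createComp ψ n (reflectComp n Φ))

/-- The operator `J a(ψ) J`, which annihilates a particle in the last argument. -/
def reflectedAnnihilate (ψ : H1) (n : ℕ) (Φ : L2 (n + 1)) : L2 n :=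
  reflectComp n (annihilateComp ψ n (reflectComp (n + 1) Φ))

lemma tail_comp_rev {n : ℕ} (θ : Fin (n + 1) → ℝ) :
    Fin.tail (θ ∘ Fin.rev) ∘ Fin.rev = Fin.init θ := by
  funext i
  simp [Fin.tail, Fin.init, Fin.rev_succ]

lemma cons_comp_rev {n : ℕ} (θ : Fin n → ℝ) (t : ℝ) :
    (Fin.cons t (θ ∘ Fin.rev) : Fin (n + 1) → ℝ) ∘ Fin.rev = Fin.snoc θ t := by
  funext i
  refine Fin.lastCases ?_ (fun i => ?_) i
  · simp
  · simp [Fin.rev_castSucc]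

lemma reflectedCreate_coeFn (ψ : H1) (n : ℕ) (Φ : L2 n) :
    reflectedCreate ψ n Φ =ᵐ[volume] fun θ : Fin (n + 1) → ℝ =>
      ((Real.sqrt (n + 1) : ℝ) : ℂ) * (conj (ψ (θ (Fin.last n))) * Φ (Fin.init θ)) := by
  filter_upwards [reflectComp_coeFn (n + 1) (createComp ψ n (reflectComp n Φ)),
    ae_rev (createComp_coeFn ψ n (reflectComp n Φ)),
    ae_rev (ae_tail (reflectComp_coeFn n Φ))] with θ h1 h2 h3
  rw [reflectedCreate, h1, h2, h3, tail_comp_rev]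
  simp

lemma ae_ae_cons {n : ℕ} {p : (Fin (n + 1) → ℝ) → Prop} (h : ∀ᵐ θ, p θ) :
    ∀ᵐ θ : Fin n → ℝ, ∀ᵐ t : ℝ, p (Fin.cons t θ) :=
  Measure.ae_ae_of_ae_prod (((measurePreserving_cons n).comp
      Measure.measurePreserving_swap).quasiMeasurePreserving.ae h)

lemma reflectedAnnihilate_coeFn (ψ : H1) (n : ℕ) (Φ : L2 (n + 1)) :
    reflectedAnnihilate ψ n Φ =ᵐ[volume] fun θ : Fin n → ℝ =>
      ((Real.sqrt (n + 1) : ℝ) : ℂ) * ∫ t : ℝ, conj (ψ t) * Φ (Fin.snoc θ t) := by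
  filter_upwards [reflectComp_coeFn n (annihilateComp ψ n (reflectComp (n + 1) Φ)),
    ae_rev (annihilateComp_coeFn ψ n (reflectComp (n + 1) Φ)),
    ae_rev (ae_ae_cons (reflectComp_coeFn (n + 1) Φ))] with θ h1 h2 h3
  rw [reflectedAnnihilate, h1, h2, map_mul, Complex.conj_ofReal, ← integral_conj]
  congr 1
  refine integral_congr_ae ?_
  filter_upwards [h3] with t h4
  rw [h4, map_mul, Complex.conj_conj, cons_comp_rev]

/-! ## Intertwining relations with the permutations -/

lemma createComp_permOp (S : ScatteringFunction) (ψ : H1) {n : ℕ} {σ : Equiv.Perm (Fin (n + 1))}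
    {e : Equiv.Perm (Fin n)} (h0 : σ 0 = 0) (h : ∀ i : Fin n, σ i.succ = (e i).succ) (Φ : L2 n) :
    createComp ψ n (permOp S e Φ) = permOp S σ (createComp ψ n Φ) := by
  refine Lp.ext ?_
  filter_upwards [createComp_coeFn ψ n (permOp S e Φ), ae_tail (permOp_coeFn S e Φ),
    permOp_coeFn S σ (createComp ψ n Φ), ae_perm σ (createComp_coeFn ψ n Φ)] with θ h1 h2 h3 h4
  have h5 : Fin.tail (θ ∘ σ) = Fin.tail θ ∘ e := by
    funext i
    simp [Fin.tail, h]
  rw [h1, h2, h3, h4, permFactor_extend_zero S h0 h, h5, Function.comp_apply, h0]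
  ring

lemma reflectedAnnihilate_permOp (S : ScatteringFunction) (ψ : H1) {n : ℕ}
    {σ : Equiv.Perm (Fin (n + 1))} {e : Equiv.Perm (Fin n)} (h0 : σ (Fin.last n) = Fin.last n)
    (h : ∀ i : Fin n, σ i.castSucc = (e i).castSucc) (Φ : L2 (n + 1)) :
    reflectedAnnihilate ψ n (permOp S σ Φ) = permOp S e (reflectedAnnihilate ψ n Φ) := by
  refine Lp.ext ?_
  filter_upwards [reflectedAnnihilate_coeFn ψ n (permOp S σ Φ), ae_ae_snoc (permOp_coeFn S σ Φ),
    permOp_coeFn S e (reflectedAnnihilate ψ n Φ),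
    ae_perm e (reflectedAnnihilate_coeFn ψ n Φ)] with θ h1 h2 h3 h4
  rw [h1, h3, h4, mul_left_comm]
  congr 1
  rw [← integral_const_mul]
  refine integral_congr_ae ?_
  filter_upwards [h2] with t h5
  have h6 : (Fin.snoc θ t : Fin (n + 1) → ℝ) ∘ σ = Fin.snoc (θ ∘ e) t := by
    funext i
    refine Fin.lastCases ?_ (fun i => ?_) i
    · simp [h0]
    · simp [h]
  rw [h5, permFactor_extend_last S h0 h, h6, Fin.init_snoc]
  ring

lemma permOp_createComp (S : ScatteringFunction) (ψ : H1) {n : ℕ} {Φ : L2 n}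
    (hΦ : Φ ∈ nParticle S n) (σ : Equiv.Perm (Fin (n + 1))) (h0 : σ 0 = 0) :
    permOp S σ (createComp ψ n Φ) = createComp ψ n Φ := by
  obtain ⟨e, he⟩ := exists_perm_fix_zero σ h0
  rw [← createComp_permOp S ψ h0 he, permOp_eq_self S e hΦ]

lemma reflectComp_symProj (S : ScatteringFunction) {n : ℕ} (Φ : L2 n) :
    reflectComp n (symProj S n Φ) = symProj S n (reflectComp n Φ) := by
  simp only [symProj_apply]
  rw [LinearMap.map_smulₛₗ, map_sum, map_inv₀, Complex.conj_natCast]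
  congr 1
  simp only [reflectComp_permOp]
  refine Fintype.sum_equiv ((Equiv.mulLeft Fin.revPerm).trans (Equiv.mulRight Fin.revPerm))
    _ _ fun π => ?_
  simp

/-- A permutation of the old arguments becomes, after creation, a permutation fixing `0`, which the
outer projection absorbs. Products of creators therefore reduce to unsymmetrized ones. -/
lemma symProj_createComp_symProj (S : ScatteringFunction) (ψ : H1) {n : ℕ} (Φ : L2 n) :
    symProj S (n + 1) (createComp ψ n (symProj S n Φ)) = symProj S (n + 1) (createComp ψ n Φ) := by
  have h : ∀ π : Equiv.Perm (Fin n), symProj S (n + 1) (createComp ψ n (permOp S π Φ)) =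
      symProj S (n + 1) (createComp ψ n Φ) := by
    intro π
    have h0 : Equiv.Perm.decomposeFin.symm ((0 : Fin (n + 1)), π) 0 = 0 := by simp
    rw [createComp_permOp S ψ h0 (fun i => by simp), symProj_permOp]
  rw [symProj_apply S Φ, map_smul, map_smul, map_sum, map_sum, Finset.sum_congr rfl fun π _ => h π,
    Finset.sum_const, Finset.card_univ, Fintype.card_perm, Fintype.card_fin,
    ← Nat.cast_smul_eq_nsmul ℂ, smul_smul,
    inv_mul_cancel₀ (Nat.cast_ne_zero.2 n.factorial_ne_zero), one_smul]

lemma symProj_reflectedCreate_symProj (S : ScatteringFunction) (ψ : H1) {n : ℕ} (Φ : L2 n) :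
    symProj S (n + 1) (reflectedCreate ψ n (symProj S n Φ)) =
      symProj S (n + 1) (reflectedCreate ψ n Φ) := by
  rw [reflectedCreate, reflectComp_symProj, ← reflectComp_symProj, symProj_createComp_symProj,
    reflectComp_symProj, reflectedCreate]

/-- Integrating out the last argument commutes with permuting the others, so symmetry survives and
no projection is needed afterwards. -/
lemma symProj_reflectedAnnihilate (S : ScatteringFunction) (ψ : H1) {n : ℕ} {Φ : L2 (n + 1)}
    (hΦ : Φ ∈ nParticle S (n + 1)) :
    symProj S n (reflectedAnnihilate ψ n Φ) = reflectedAnnihilate ψ n Φ := by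
  refine symProj_eq_self_of_forall S fun e => ?_
  obtain ⟨σ, h0, h⟩ := exists_perm_extend e
  rw [← reflectedAnnihilate_permOp S ψ h0 h, permOp_eq_self S σ hΦ]

lemma symProj_annihilateComp (S : ScatteringFunction) (ψ : H1) {n : ℕ} {Φ : L2 (n + 1)}
    (hΦ : Φ ∈ nParticle S (n + 1)) :
    symProj S n (annihilateComp ψ n Φ) = annihilateComp ψ n Φ := by
  have h := symProj_reflectedAnnihilate S ψ (reflectComp_mem S hΦ)
  rw [reflectedAnnihilate, reflectComp_reflectComp, ← reflectComp_symProj] at h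
  rw [← reflectComp_reflectComp (symProj S n _), h, reflectComp_reflectComp]

/-! ## Commutation relations -/

lemma reflectedCreate_createComp (ψ χ : H1) {n : ℕ} (Φ : L2 n) :
    reflectedCreate ψ (n + 1) (createComp χ n Φ) = createComp χ (n + 1) (reflectedCreate ψ n Φ) := by
  refine Lp.ext ?_
  filter_upwards [reflectedCreate_coeFn ψ (n + 1) (createComp χ n Φ),
    ae_init (createComp_coeFn χ n Φ), createComp_coeFn χ (n + 1) (reflectedCreate ψ n Φ),
    ae_tail (reflectedCreate_coeFn ψ n Φ)] with θ h1 h2 h3 h4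
  have h5 : Fin.init (Fin.tail θ) = Fin.tail (Fin.init θ) := Fin.tail_init_eq_init_tail θ |>.symm
  rw [h1, h2, h3, h4, h5]
  simp only [Fin.init, Fin.tail, Fin.castSucc_zero, Fin.succ_last]
  ring

/-- The adjoint relation lets commutation of annihilators be deduced from commutation of creators,
where no integral occurs. -/
lemma inner_annihilateComp (ψ : H1) {n : ℕ} (Φ : L2 n) (Ψ : L2 (n + 1)) :
    inner ℂ Φ (annihilateComp ψ n Ψ) = inner ℂ (createComp (star ψ) n Φ) Ψ := by
  have hmp := (volume_preserving_piFinSuccAbove (fun _ : Fin (n + 1) => ℝ) 0).symm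
  have hcons : ∀ q : ℝ × (Fin n → ℝ), (MeasurableEquiv.piFinSuccAbove
      (fun _ : Fin (n + 1) => ℝ) 0).symm q = (Fin.cons q.1 q.2 : Fin (n + 1) → ℝ) :=
    fun q => Fin.insertNth_zero' q.1 q.2
  have hint := hmp.integrable_comp_of_integrable
    (L2.integrable_inner (𝕜 := ℂ) (createComp (star ψ) n Φ) Ψ)
  rw [L2.inner_def, L2.inner_def, ← hmp.integral_comp']
  refine Eq.trans ?_ (integral_prod_symm _ hint).symm
  refine integral_congr_ae ?_
  filter_upwards [annihilateComp_coeFn ψ n Ψ, ae_ae_cons (createComp_coeFn (star ψ) n Φ)]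
    with θ h1 h2
  rw [h1, RCLike.inner_apply, mul_comm, mul_left_comm, ← mul_assoc, ← integral_const_mul]
  refine integral_congr_ae ?_
  filter_upwards [h2, Lp.coeFn_star ψ] with t h3 h4
  simp only [Function.comp_apply, hcons]
  rw [h3, Fin.cons_zero, Fin.tail_cons, h4, RCLike.inner_apply]
  simp only [Pi.star_apply, RCLike.star_def, map_mul, Complex.conj_conj, Complex.conj_ofReal]
  ring

lemma inner_reflectComp {n : ℕ} (Φ Ψ : L2 n) :
    inner ℂ (reflectComp n Φ) Ψ = inner ℂ (reflectComp n Ψ) Φ := by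
  have hmp : MeasurePreserving (MeasurableEquiv.arrowCongr' (Fin.revPerm (n := n)).symm
      (MeasurableEquiv.refl ℝ)) volume volume :=
    volume_preserving_arrowCongr' _ (MeasurableEquiv.refl ℝ) (MeasurePreserving.id _)
  have he : ∀ θ : Fin n → ℝ, MeasurableEquiv.arrowCongr' (Fin.revPerm (n := n)).symm
      (MeasurableEquiv.refl ℝ) θ = θ ∘ Fin.rev := fun θ => rfl
  rw [L2.inner_def, L2.inner_def, ← hmp.integral_comp']
  refine integral_congr_ae ?_
  filter_upwards [ae_rev (reflectComp_coeFn n Φ), reflectComp_coeFn n Ψ] with θ h1 h2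
  simp only [he]
  have h3 : (θ ∘ Fin.rev) ∘ Fin.rev = θ := by
    funext i
    simp
  rw [h1, h2, h3, RCLike.inner_apply, RCLike.inner_apply, Complex.conj_conj, Complex.conj_conj,
    mul_comm]

lemma inner_reflectedAnnihilate (ψ : H1) {n : ℕ} (Φ : L2 n) (Ψ : L2 (n + 1)) :
    inner ℂ Φ (reflectedAnnihilate ψ n Ψ) = inner ℂ (reflectedCreate (star ψ) n Φ) Ψ := by
  rw [reflectedCreate, inner_reflectComp (createComp (star ψ) n (reflectComp n Φ)),
    reflectedAnnihilate, ← inner_conj_symm,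
    inner_reflectComp (annihilateComp ψ n (reflectComp (n + 1) Ψ)), inner_annihilateComp,
    inner_conj_symm]

lemma reflectedAnnihilate_annihilateComp (ψ χ : H1) {n : ℕ} (Φ : L2 (n + 2)) :
    reflectedAnnihilate ψ n (annihilateComp χ (n + 1) Φ) =
      annihilateComp χ n (reflectedAnnihilate ψ (n + 1) Φ) := by
  refine ext_inner_left ℂ fun Ψ => ?_
  rw [inner_reflectedAnnihilate, inner_annihilateComp, inner_annihilateComp,
    inner_reflectedAnnihilate, reflectedCreate_createComp]

/-- With at least one old particle, the first and last slots are distinct and the operations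
commute. Only the normalization changes: `√(n+2)` twice on the left, `√(n+1)` twice on the right. -/
lemma reflectedAnnihilate_createComp (ψ χ : H1) {n : ℕ} (Φ : L2 (n + 1)) :
    reflectedAnnihilate ψ (n + 1) (createComp χ (n + 1) Φ) =
      (((n : ℂ) + 2) / (n + 1)) • createComp χ n (reflectedAnnihilate ψ n Φ) := by
  refine Lp.ext ?_
  filter_upwards [reflectedAnnihilate_coeFn ψ (n + 1) (createComp χ (n + 1) Φ),
    ae_ae_snoc (createComp_coeFn χ (n + 1) Φ), createComp_coeFn χ n (reflectedAnnihilate ψ n Φ),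
    ae_tail (reflectedAnnihilate_coeFn ψ n Φ),
    Lp.coeFn_smul (((n : ℂ) + 2) / (n + 1)) (createComp χ n (reflectedAnnihilate ψ n Φ))]
    with θ h1 h2 h3 h4 h5
  have h6 : ∫ t : ℝ, conj (ψ t) * createComp χ (n + 1) Φ (Fin.snoc θ t) =
      ((Real.sqrt ((n + 1 : ℕ) + 1) : ℝ) : ℂ) * χ (θ 0) *
        ∫ t : ℝ, conj (ψ t) * Φ (Fin.snoc (Fin.tail θ) t) := by
    rw [← integral_const_mul]
    refine integral_congr_ae ?_
    filter_upwards [h2] with t h7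
    have h8 : Fin.tail (Fin.snoc θ t : Fin (n + 2) → ℝ) = Fin.snoc (Fin.tail θ) t := by
      funext i
      refine Fin.lastCases ?_ (fun i => ?_) i
      · simp [Fin.tail]
      · simp [Fin.tail, ← Fin.castSucc_succ]
    have h9 : (Fin.snoc θ t : Fin (n + 2) → ℝ) 0 = θ 0 := by
      rw [← Fin.castSucc_zero, Fin.snoc_castSucc]
    rw [h7, h8, h9]
    ring
  rw [h1, h5, Pi.smul_apply, h3, h4, h6, smul_eq_mul]
  have e1 : ((Real.sqrt ((n + 1 : ℕ) + 1) : ℝ) : ℂ) * ((Real.sqrt ((n + 1 : ℕ) + 1) : ℝ) : ℂ) =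
      n + 2 := by
    rw [← Complex.ofReal_mul, Real.mul_self_sqrt (by positivity)]
    push_cast
    ring
  have e2 : ((Real.sqrt (n + 1) : ℝ) : ℂ) * ((Real.sqrt (n + 1) : ℝ) : ℂ) = n + 1 := by
    rw [← Complex.ofReal_mul, Real.mul_self_sqrt (by positivity)]
    push_cast
    ring
  have h0 : (n + 1 : ℂ) ≠ 0 := Nat.cast_add_one_ne_zero n
  generalize (∫ t : ℝ, conj (ψ t) * Φ (Fin.snoc (Fin.tail θ) t)) = I
  trans (n + 2 : ℂ) * (χ (θ 0) * I)
  · rw [← e1]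
    ring
  · rw [div_mul_eq_mul_div, eq_div_iff h0, ← e2]
    ring

/-- The factor `∫ conj (ψ t) χ(t) ∏_j S₂(t - θ_j) dt`. -/
def exchangeFactor (S : ScatteringFunction) (ψ χ : H1) {n : ℕ} (θ : Fin n → ℝ) : ℂ :=
  ∫ t : ℝ, conj (ψ t) * χ t * ∏ j, S.onReal (t - θ j)

/-- Here the created particle has been carried to the last slot and is itself annihilated. It leaves
behind its scattering factors with all the others. -/
lemma reflectedAnnihilate_permOp_last (S : ScatteringFunction) (ψ χ : H1) {n : ℕ} (Φ : L2 n) :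
    reflectedAnnihilate ψ n (permOp S (Fin.last n).cycleRange.symm (createComp χ n Φ))
      =ᵐ[volume] fun θ => (n + 1 : ℂ) * (exchangeFactor S ψ χ θ * Φ θ) := by
  filter_upwards [reflectedAnnihilate_coeFn ψ n
      (permOp S (Fin.last n).cycleRange.symm (createComp χ n Φ)),
    ae_ae_snoc (permOp_coeFn S (Fin.last n).cycleRange.symm (createComp χ n Φ)),
    ae_ae_snoc (ae_perm (Fin.last n).cycleRange.symm (createComp_coeFn χ n Φ))] with θ h1 h2 h3
  have e2 : ((Real.sqrt (n + 1) : ℝ) : ℂ) * ((Real.sqrt (n + 1) : ℝ) : ℂ) = n + 1 := by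
    rw [← Complex.ofReal_mul, Real.mul_self_sqrt (by positivity)]
    push_cast
    ring
  rw [h1, ← e2, mul_assoc]
  congr 1
  rw [exchangeFactor, ← mul_assoc, ← integral_const_mul, ← integral_mul_const]
  refine integral_congr_ae ?_
  filter_upwards [h2, h3] with t h4 h5
  rw [h4, h5, tail_comp_cycleRange_last, comp_cycleRange_last_zero, permFactor_cycleRange_last,
    Fin.init_snoc, Fin.snoc_last]
  simp only [Fin.snoc_castSucc]
  ring

lemma reflectedAnnihilate_smul (ψ : H1) {n : ℕ} (c : ℂ) (Φ : L2 (n + 1)) :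
    reflectedAnnihilate ψ n (c • Φ) = c • reflectedAnnihilate ψ n Φ := by
  simp only [reflectedAnnihilate]
  rw [LinearMap.map_smulₛₗ, map_smul, LinearMap.map_smulₛₗ, Complex.conj_conj]

lemma reflectedAnnihilate_sum (ψ : H1) {n : ℕ} {ι : Type*} (s : Finset ι) (Φ : ι → L2 (n + 1)) :
    reflectedAnnihilate ψ n (∑ i ∈ s, Φ i) = ∑ i ∈ s, reflectedAnnihilate ψ n (Φ i) := by
  simp only [reflectedAnnihilate, map_sum]

/-- Multiplication by `exchangeFactor S ψ χ`, written as an operator on `L²(ℝⁿ)`. -/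
def exchangeOp (S : ScatteringFunction) (ψ χ : H1) {n : ℕ} (Φ : L2 n) : L2 n :=
  (n + 1 : ℂ)⁻¹ •
    reflectedAnnihilate ψ n (permOp S (Fin.last n).cycleRange.symm (createComp χ n Φ))

/-- Since `exchangeOp` is a composite of operators, the square integrability of this product needs
no separate proof. -/
lemma exchangeOp_coeFn (S : ScatteringFunction) (ψ χ : H1) {n : ℕ} (Φ : L2 n) :
    exchangeOp S ψ χ Φ =ᵐ[volume] fun θ => exchangeFactor S ψ χ θ * Φ θ := by
  filter_upwards [reflectedAnnihilate_permOp_last S ψ χ Φ, Lp.coeFn_smul ((n + 1 : ℂ)⁻¹)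
    (reflectedAnnihilate ψ n (permOp S (Fin.last n).cycleRange.symm (createComp χ n Φ)))]
    with θ h1 h2
  rw [exchangeOp, h2, Pi.smul_apply, h1, smul_eq_mul,
    inv_mul_cancel_left₀ (Nat.cast_add_one_ne_zero n)]

lemma reflectedAnnihilate_symProj_createComp_zero (S : ScatteringFunction) (ψ χ : H1) {Φ : L2 0}
    (hΦ : Φ ∈ nParticle S 0) :
    reflectedAnnihilate ψ 0 (symProj S 1 (createComp χ 0 Φ)) = exchangeOp S ψ χ Φ := by
  rw [symProj_succ S _ (permOp_createComp S χ hΦ), reflectedAnnihilate_smul,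
    reflectedAnnihilate_sum, exchangeOp, Fin.sum_univ_castSucc, Finset.univ_eq_empty,
    Finset.sum_empty, zero_add]

/-- The coset terms `j.castSucc` leave the last slot alone, so the annihilator passes through them
and they rebuild `P_{n+1}`; the last coset term is the exchange. The weights match because `(n+2)⁻¹
· (n+2)/(n+1) = (n+1)⁻¹`. -/
lemma reflectedAnnihilate_symProj_createComp_succ (S : ScatteringFunction) (ψ χ : H1) {n : ℕ}
    {Φ : L2 (n + 1)} (hΦ : Φ ∈ nParticle S (n + 1)) :
    reflectedAnnihilate ψ (n + 1) (symProj S (n + 2) (createComp χ (n + 1) Φ)) =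
      symProj S (n + 1) (createComp χ n (reflectedAnnihilate ψ n Φ)) + exchangeOp S ψ χ Φ := by
  have hsym : reflectedAnnihilate ψ n Φ ∈ nParticle S n :=
    ⟨_, symProj_reflectedAnnihilate S ψ hΦ⟩
  have h1 : ∀ j : Fin (n + 1), reflectedAnnihilate ψ (n + 1)
      (permOp S j.castSucc.cycleRange.symm (createComp χ (n + 1) Φ)) =
      (((n : ℂ) + 2) / (n + 1)) •
        permOp S j.cycleRange.symm (createComp χ n (reflectedAnnihilate ψ n Φ)) := fun j => by
    rw [reflectedAnnihilate_permOp S ψ (cycleRange_symm_castSucc_last j)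
      (cycleRange_symm_castSucc_castSucc j), reflectedAnnihilate_createComp, map_smul]
  rw [symProj_succ S _ (permOp_createComp S χ hΦ), reflectedAnnihilate_smul,
    reflectedAnnihilate_sum, exchangeOp, Fin.sum_univ_castSucc, smul_add,
    Finset.sum_congr rfl fun j _ => h1 j, ← Finset.smul_sum, smul_smul,
    symProj_succ S _ (permOp_createComp S χ hsym)]
  congr 2
  have h2 : (n + 1 : ℂ) ≠ 0 := Nat.cast_add_one_ne_zero n
  have h3 : ((n : ℂ) + 2) ≠ 0 := by exact_mod_cast (by omega : n + 2 ≠ 0)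
  have h4 : ((n + 1 : ℕ) : ℂ) + 1 = n + 2 := by
    push_cast
    ring
  rw [h4]
  field_simp

/-! ## Commutators on the finite particle vectors -/

section Operators

variable (S : ScatteringFunction)

lemma domain_ext {Φ Ψ : domain S} (h : ∀ n, (Φ : Fock) n = (Ψ : Fock) n) : Φ = Ψ :=
  Subtype.ext (lp.ext (funext h))

lemma domain_mem (Ψ : domain S) (n : ℕ) : (Ψ : Fock) n ∈ nParticle S n := Ψ.2.1 n

lemma J_apply (Ψ : domain S) (n : ℕ) : (J S Ψ : Fock) n = reflectComp n ((Ψ : Fock) n) := rfl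

lemma J_J (Ψ : domain S) : J S (J S Ψ) = Ψ :=
  domain_ext S fun n => by rw [J_apply, J_apply, reflectComp_reflectComp]

lemma zAnn_apply (ψ : H1) (Ψ : domain S) (n : ℕ) :
    (zAnn S ψ Ψ : Fock) n = annihilateComp ψ n ((Ψ : Fock) (n + 1)) := by
  have h : (zAnn S ψ Ψ : Fock) n =
      symProj S n (annihilateComp ψ n (symProj S (n + 1) ((Ψ : Fock) (n + 1)))) := rfl
  rw [h, symProj_eq_self S (domain_mem S Ψ _), symProj_annihilateComp S ψ (domain_mem S Ψ _)]

lemma zCre_apply_zero (ψ : H1) (Ψ : domain S) : (zCre S ψ Ψ : Fock) 0 = 0 :=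
  map_zero (symProj S 0)

lemma zCre_apply_succ (ψ : H1) (Ψ : domain S) (n : ℕ) :
    (zCre S ψ Ψ : Fock) (n + 1) = symProj S (n + 1) (createComp ψ n ((Ψ : Fock) n)) :=
  symProj_createComp_symProj S ψ _

/-- The reflected annihilation operator `J z(ψ) J`. -/
def reflectedZAnn (ψ : H1) : domain S →ₗ[ℂ] domain S := (J S).comp ((zAnn S ψ).comp (J S))

/-- The reflected creation operator `J z†(ψ) J`. -/
def reflectedZCre (ψ : H1) : domain S →ₗ[ℂ] domain S := (J S).comp ((zCre S ψ).comp (J S))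

lemma reflectedZAnn_eq (ψ : H1) (Ψ : domain S) :
    reflectedZAnn S ψ Ψ = J S (zAnn S ψ (J S Ψ)) := rfl

lemma reflectedZCre_eq (ψ : H1) (Ψ : domain S) :
    reflectedZCre S ψ Ψ = J S (zCre S ψ (J S Ψ)) := rfl

lemma reflectedZAnn_apply (ψ : H1) (Ψ : domain S) (n : ℕ) :
    (reflectedZAnn S ψ Ψ : Fock) n = reflectedAnnihilate ψ n ((Ψ : Fock) (n + 1)) := by
  rw [reflectedZAnn_eq, J_apply, zAnn_apply, J_apply, reflectedAnnihilate]

lemma reflectedZCre_apply_zero (ψ : H1) (Ψ : domain S) :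
    (reflectedZCre S ψ Ψ : Fock) 0 = 0 := by
  rw [reflectedZCre_eq, J_apply, zCre_apply_zero, map_zero]

lemma reflectedZCre_apply_succ (ψ : H1) (Ψ : domain S) (n : ℕ) :
    (reflectedZCre S ψ Ψ : Fock) (n + 1) =
      symProj S (n + 1) (reflectedCreate ψ n ((Ψ : Fock) n)) := by
  rw [reflectedZCre_eq, J_apply, zCre_apply_succ, J_apply, reflectComp_symProj, reflectedCreate]

lemma reflectedZCre_zCre (ψ χ : H1) (Ψ : domain S) :
    reflectedZCre S ψ (zCre S χ Ψ) = zCre S χ (reflectedZCre S ψ Ψ) := by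
  refine domain_ext S fun n => ?_
  match n with
  | 0 => rw [reflectedZCre_apply_zero, zCre_apply_zero]
  -- Both sides create from a zero-particle component, which vanishes for any created vector.
  | 1 =>
    rw [reflectedZCre_apply_succ, zCre_apply_succ, zCre_apply_zero, reflectedZCre_apply_zero,
      reflectedCreate]
    simp only [map_zero]
  | n + 2 =>
    rw [reflectedZCre_apply_succ, zCre_apply_succ, zCre_apply_succ, reflectedZCre_apply_succ,
      symProj_createComp_symProj, symProj_reflectedCreate_symProj, reflectedCreate_createComp]

lemma reflectedZAnn_zAnn (ψ χ : H1) (Ψ : domain S) :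
    reflectedZAnn S ψ (zAnn S χ Ψ) = zAnn S χ (reflectedZAnn S ψ Ψ) := by
  refine domain_ext S fun n => ?_
  rw [reflectedZAnn_apply, zAnn_apply, zAnn_apply, reflectedZAnn_apply,
    reflectedAnnihilate_annihilateComp]

lemma reflectedZAnn_zCre (ψ χ : H1) (Ψ : domain S) (n : ℕ) :
    (reflectedZAnn S ψ (zCre S χ Ψ) : Fock) n =
      (zCre S χ (reflectedZAnn S ψ Ψ) : Fock) n + exchangeOp S ψ χ ((Ψ : Fock) n) := by
  rw [reflectedZAnn_apply, zCre_apply_succ]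
  cases n with
  | zero =>
    rw [reflectedAnnihilate_symProj_createComp_zero S ψ χ (domain_mem S Ψ 0), zCre_apply_zero,
      zero_add]
  | succ n =>
    rw [reflectedAnnihilate_symProj_createComp_succ S ψ χ (domain_mem S Ψ (n + 1)),
      zCre_apply_succ, reflectedZAnn_apply]

/-- This is the previous relation with `ψ` and `χ` interchanged, applied to `JΨ` and conjugated by
`J`. -/
lemma zAnn_reflectedZCre (ψ χ : H1) (Ψ : domain S) (n : ℕ) :
    (zAnn S χ (reflectedZCre S ψ Ψ) : Fock) n =
      (reflectedZCre S ψ (zAnn S χ Ψ) : Fock) n +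
        reflectComp n (exchangeOp S χ ψ (reflectComp n ((Ψ : Fock) n))) := by
  have h := congrArg (reflectComp n) (reflectedZAnn_zCre S χ ψ (J S Ψ) n)
  rw [map_add, ← J_apply, ← J_apply, J_apply S Ψ, reflectedZAnn_eq, reflectedZAnn_eq, J_J, J_J,
    ← reflectedZCre_eq, ← reflectedZCre_eq] at h
  exact h

lemma reflectComp_exchangeOp_coeFn (ψ χ : H1) {n : ℕ} (Φ : L2 n) :
    reflectComp n (exchangeOp S χ ψ (reflectComp n Φ)) =ᵐ[volume]
      fun θ => conj (exchangeFactor S χ ψ (θ ∘ Fin.rev)) * Φ θ := by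
  filter_upwards [reflectComp_coeFn n (exchangeOp S χ ψ (reflectComp n Φ)),
    ae_rev (exchangeOp_coeFn S χ ψ (reflectComp n Φ)), ae_rev (reflectComp_coeFn n Φ)]
    with θ h1 h2 h3
  have h4 : (θ ∘ Fin.rev) ∘ Fin.rev = θ := by
    funext i
    simp
  rw [h1, h2, map_mul, h3, h4, Complex.conj_conj]

lemma conj_exchangeFactor_rev (ψ χ : H1) {n : ℕ} (θ : Fin n → ℝ) :
    conj (exchangeFactor S χ ψ (θ ∘ Fin.rev)) =
      ∫ t : ℝ, χ t * conj (ψ t) * ∏ j, S.onReal (θ j - t) := by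
  rw [exchangeFactor, ← integral_conj]
  refine integral_congr_ae (Filter.Eventually.of_forall fun t => ?_)
  simp only [map_mul, map_prod, Complex.conj_conj, S.conj_onReal, neg_sub, Function.comp_apply]
  congr 1
  -- The product is symmetric in the `θ_j`, so their reversal disappears.
  exact Fintype.prod_equiv Fin.revPerm _ _ fun j => rfl

/-- The mixed commutators are two multiplication operators entering with opposite signs, and `h`
says that their multipliers agree. -/
theorem commutator_eq_zero (ψ₁ ψ₂ χ₁ χ₂ : H1)
    (h : ∀ (n : ℕ) (θ : Fin n → ℝ), ∫ t : ℝ, conj (ψ₁ t) * χ₁ t * ∏ j, S.onReal (t - θ j) =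
      ∫ t : ℝ, χ₂ t * conj (ψ₂ t) * ∏ j, S.onReal (θ j - t)) (Ψ : domain S) :
    (reflectedZCre S ψ₂ + reflectedZAnn S ψ₁) ((zCre S χ₁ + zAnn S χ₂) Ψ) =
      (zCre S χ₁ + zAnn S χ₂) ((reflectedZCre S ψ₂ + reflectedZAnn S ψ₁) Ψ) := by
  refine domain_ext S fun n => ?_
  have hE : exchangeOp S ψ₁ χ₁ ((Ψ : Fock) n) =
      reflectComp n (exchangeOp S χ₂ ψ₂ (reflectComp n ((Ψ : Fock) n))) := by
    refine Lp.ext ?_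
    filter_upwards [exchangeOp_coeFn S ψ₁ χ₁ ((Ψ : Fock) n),
      reflectComp_exchangeOp_coeFn S ψ₂ χ₂ ((Ψ : Fock) n)] with θ h1 h2
    rw [h1, h2, conj_exchangeFactor_rev, ← h, exchangeFactor]
  have hD := reflectedZAnn_zCre S ψ₁ χ₁ Ψ n
  have hC := zAnn_reflectedZCre S ψ₂ χ₂ Ψ n
  simp only [LinearMap.add_apply, map_add, Submodule.coe_add, lp.coeFn_add, Pi.add_apply]
  rw [hD, hC, hE, reflectedZCre_zCre, reflectedZAnn_zAnn]
  abel

end Operators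

open Filter Topology

/-! ## Analytic continuation of the one-particle vectors -/


/-- The complex Minkowski product `p(ζ) · x` for complex rapidity `ζ`. -/
def phase (m : ℝ) (ζ : ℂ) (x : Spacetime) : ℂ :=
  m * (Complex.cosh ζ * x 0 - Complex.sinh ζ * x 1)

/-- The function `ζ ↦ (1/2π) ∫ f(x) e^{-i p(ζ)·x} d²x`. -/
def contFun (m : ℝ) (f : 𝓢(Spacetime, ℂ)) (ζ : ℂ) : ℂ :=
  (1 / (2 * Real.pi) : ℂ) * ∫ x, f x * Complex.exp (-(Complex.I * phase m ζ x))

lemma phase_ofReal (m θ : ℝ) (x : Spacetime) : phase m θ x = minkowski (momentum m θ) x := by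
  simp [phase, minkowski, momentum]
  ring

/-- Shifting the rapidity by `iπ` reverses the momentum. This is why `f⁺` and `f⁻` are boundary
values of the same function. -/
lemma phase_add_pi (m : ℝ) (ζ : ℂ) (x : Spacetime) :
    phase m (ζ + Real.pi * Complex.I) x = -phase m ζ x := by
  simp only [phase, Complex.cosh_add, Complex.sinh_add, Complex.cosh_mul_I, Complex.sinh_mul_I,
    ← Complex.ofReal_cos, ← Complex.ofReal_sin, Real.cos_pi, Real.sin_pi]
  push_cast
  ring

lemma phase_neg (m : ℝ) (ζ : ℂ) (x : Spacetime) : phase m ζ (-x) = -phase m ζ x := by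
  simp [phase]
  ring

lemma plusFun_eq_contFun (m : ℝ) (f : 𝓢(Spacetime, ℂ)) (θ : ℝ) :
    plusFun m f θ = contFun m f (θ + Real.pi * Complex.I) := by
  simp only [plusFun, contFun, phase_add_pi, phase_ofReal, mul_neg, neg_neg]

lemma minusFun_eq_contFun (m : ℝ) (f : 𝓢(Spacetime, ℂ)) (θ : ℝ) :
    minusFun m f θ = contFun m f θ := by
  rw [minusFun, contFun, ← integral_neg_eq_self]
  congr 2
  funext x
  rw [neg_neg, ← phase_ofReal, phase_neg, mul_neg]

lemma minusFun_negTest (m : ℝ) (f : 𝓢(Spacetime, ℂ)) (θ : ℝ) :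
    minusFun m (negTest f) θ = plusFun m f θ := by
  simp only [minusFun, plusFun, negTest_apply, neg_neg]

lemma plusFun_negTest (m : ℝ) (f : 𝓢(Spacetime, ℂ)) (θ : ℝ) :
    plusFun m (negTest f) θ = minusFun m f θ := rfl

/-- The conjugation coming from `J` undoes the one in `f*`, so the exchange integrals contain `f^±`
themselves. -/
lemma plusFun_starTest (m : ℝ) (f : 𝓢(Spacetime, ℂ)) (θ : ℝ) :
    conj (plusFun m (starTest f) θ) = plusFun m f θ := by
  simp only [plusFun, map_mul]
  rw [← integral_conj, ← integral_neg_eq_self]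
  congr 1
  · simp [map_ofNat]
  · congr 1
    funext x
    rw [starTest_apply, map_mul, Complex.conj_conj, ← Complex.exp_conj, neg_neg, ← phase_ofReal,
      ← phase_ofReal, phase_neg, phase_ofReal]
    simp

lemma minusFun_starTest (m : ℝ) (f : 𝓢(Spacetime, ℂ)) (θ : ℝ) :
    conj (minusFun m (starTest f) θ) = minusFun m f θ := by
  simp only [minusFun, map_mul]
  rw [← integral_conj, ← integral_neg_eq_self]
  congr 1
  · simp [map_ofNat]
  · congr 1
    funext x
    rw [starTest_apply, map_mul, Complex.conj_conj, ← Complex.exp_conj, neg_neg, ← phase_ofReal,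
      ← phase_ofReal, phase_neg, phase_ofReal]
    simp

/-! ### Damping of plane waves on the right wedge -/

lemma phase_im (m : ℝ) (ζ : ℂ) (x : Spacetime) :
    (phase m ζ x).im =
      m * Real.sin ζ.im * (Real.sinh ζ.re * x 0 - Real.cosh ζ.re * x 1) := by
  have h1 : Complex.cosh ζ = Real.cosh ζ.re * Real.cos ζ.im +
      Real.sinh ζ.re * Real.sin ζ.im * Complex.I := by
    conv_lhs => rw [← Complex.re_add_im ζ]
    rw [Complex.cosh_add, Complex.cosh_mul_I, Complex.sinh_mul_I]
    push_cast
    ring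
  have h2 : Complex.sinh ζ = Real.sinh ζ.re * Real.cos ζ.im +
      Real.cosh ζ.re * Real.sin ζ.im * Complex.I := by
    conv_lhs => rw [← Complex.re_add_im ζ]
    rw [Complex.sinh_add, Complex.cosh_mul_I, Complex.sinh_mul_I]
    push_cast
    ring
  have h3 : phase m ζ x = ((m * (Real.cosh ζ.re * Real.cos ζ.im * x 0 -
      Real.sinh ζ.re * Real.cos ζ.im * x 1) : ℝ) : ℂ) +
      ((m * Real.sin ζ.im * (Real.sinh ζ.re * x 0 - Real.cosh ζ.re * x 1) : ℝ) : ℂ) *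
        Complex.I := by
    rw [phase, h1, h2]
    push_cast
    ring
  rw [h3]
  simp only [Complex.add_im, Complex.ofReal_im, Complex.mul_im, Complex.ofReal_re, Complex.I_re,
    Complex.I_im]
  ring

lemma norm_exp_phase (m : ℝ) (ζ : ℂ) (x : Spacetime) :
    ‖Complex.exp (-(Complex.I * phase m ζ x))‖ = Real.exp (phase m ζ x).im := by
  rw [Complex.norm_exp]
  simp

/-- The estimate rests on `|sinh| ≤ cosh`. On the wedge `x₁ - |x₀| > 0`, so it bounds the plane wave
by 1 on the closed strip and forces decay as `|Re ζ| → ∞` at each interior height. -/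
lemma phase_im_le {m : ℝ} (hm : 0 < m) {ζ : ℂ} (hζ : ζ ∈ closedStrip) (x : Spacetime) :
    (phase m ζ x).im ≤ -(m * Real.sin ζ.im * (x 1 - |x 0|)) * Real.cosh ζ.re := by
  have h1 : 0 ≤ m * Real.sin ζ.im := mul_nonneg hm.le (Real.sin_nonneg_of_nonneg_of_le_pi hζ.1 hζ.2)
  have h2 : Real.sinh ζ.re * x 0 ≤ Real.cosh ζ.re * |x 0| := by
    have h3 : |Real.sinh ζ.re| ≤ Real.cosh ζ.re := by
      refine abs_le_of_sq_le_sq ?_ (Real.cosh_pos _).le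
      rw [Real.cosh_sq]
      linarith
    calc Real.sinh ζ.re * x 0 ≤ |Real.sinh ζ.re * x 0| := le_abs_self _
      _ = |Real.sinh ζ.re| * |x 0| := abs_mul _ _
      _ ≤ _ := mul_le_mul_of_nonneg_right h3 (abs_nonneg _)
  rw [phase_im]
  have := mul_le_mul_of_nonneg_left h2 h1
  linarith

lemma phase_im_nonpos {m : ℝ} (hm : 0 < m) {ζ : ℂ} (hζ : ζ ∈ closedStrip) {x : Spacetime}
    (hx : x ∈ rightWedge) : (phase m ζ x).im ≤ 0 := by
  refine (phase_im_le hm hζ x).trans ?_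
  have h1 : 0 ≤ m * Real.sin ζ.im := mul_nonneg hm.le (Real.sin_nonneg_of_nonneg_of_le_pi hζ.1 hζ.2)
  have h2 : 0 ≤ x 1 - |x 0| := sub_nonneg.2 (le_of_lt hx)
  have h3 := (Real.cosh_pos ζ.re).le
  rw [neg_mul]
  exact neg_nonpos.2 (by positivity)

lemma continuous_phase (m : ℝ) (ζ : ℂ) : Continuous (phase m ζ) := by
  unfold phase
  fun_prop

lemma differentiable_phase (m : ℝ) (x : Spacetime) : Differentiable ℂ fun ζ => phase m ζ x := by
  unfold phase
  fun_prop

lemma norm_integrand_le {m : ℝ} (hm : 0 < m) {f : 𝓢(Spacetime, ℂ)}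
    (hf : Function.support f ⊆ rightWedge) {ζ : ℂ} (hζ : ζ ∈ closedStrip) (x : Spacetime) :
    ‖f x * Complex.exp (-(Complex.I * phase m ζ x))‖ ≤ ‖f x‖ := by
  by_cases hx : f x = 0
  · simp [hx]
  · rw [norm_mul, norm_exp_phase]
    exact mul_le_of_le_one_right (norm_nonneg _)
      (Real.exp_le_one_iff.2 (phase_im_nonpos hm hζ (hf hx)))

lemma continuous_integrand (m : ℝ) (f : 𝓢(Spacetime, ℂ)) (ζ : ℂ) :
    Continuous fun x => f x * Complex.exp (-(Complex.I * phase m ζ x)) :=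
  f.continuous.mul (continuous_const.mul (continuous_phase m ζ)).neg.cexp

lemma norm_contFun_le {m : ℝ} (hm : 0 < m) {f : 𝓢(Spacetime, ℂ)}
    (hf : Function.support f ⊆ rightWedge) {ζ : ℂ} (hζ : ζ ∈ closedStrip) :
    ‖contFun m f ζ‖ ≤ ‖(1 / (2 * Real.pi) : ℂ)‖ * ∫ x, ‖f x‖ := by
  rw [contFun, norm_mul]
  refine mul_le_mul_of_nonneg_left ?_ (norm_nonneg _)
  exact norm_integral_le_of_norm_le f.integrable.norm
    (Eventually.of_forall (norm_integrand_le hm hf hζ))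

lemma continuousOn_contFun {m : ℝ} (hm : 0 < m) {f : 𝓢(Spacetime, ℂ)}
    (hf : Function.support f ⊆ rightWedge) : ContinuousOn (contFun m f) closedStrip := by
  refine continuousOn_const.mul (continuousOn_of_dominated (bound := fun x => ‖f x‖)
    (fun ζ _ => (continuous_integrand m f ζ).aestronglyMeasurable)
    (fun ζ hζ => Eventually.of_forall (norm_integrand_le hm hf hζ)) f.integrable.norm
    (Eventually.of_forall fun x => ?_))
  exact (continuous_const.mul
    (continuous_const.mul (differentiable_phase m x).continuous).neg.cexp).continuousOn

lemma isOpen_strip : IsOpen strip :=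
  (isOpen_lt continuous_const Complex.continuous_im).inter
    (isOpen_lt Complex.continuous_im continuous_const)

lemma strip_subset_closedStrip : strip ⊆ closedStrip := fun _ h => ⟨h.1.le, h.2.le⟩

lemma hasDerivAt_phase (m : ℝ) (ζ : ℂ) (x : Spacetime) :
    HasDerivAt (fun ζ => phase m ζ x)
      (m * (Complex.sinh ζ * x 0 - Complex.cosh ζ * x 1)) ζ :=
  (((Complex.hasDerivAt_cosh ζ).mul_const _).sub
    ((Complex.hasDerivAt_sinh ζ).mul_const _)).const_mul _

lemma differentiableOn_contFun {m : ℝ} (hm : 0 < m) {f : 𝓢(Spacetime, ℂ)}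
    (hf : Function.support f ⊆ rightWedge) : DifferentiableOn ℂ (contFun m f) strip := by
  intro ζ₀ hζ₀
  refine DifferentiableAt.differentiableWithinAt (DifferentiableAt.const_mul ?_ _)
  obtain ⟨K₁, hK₁⟩ := (isCompact_closedBall ζ₀ 1).exists_bound_of_continuousOn
    Complex.continuous_sinh.continuousOn
  obtain ⟨K₂, hK₂⟩ := (isCompact_closedBall ζ₀ 1).exists_bound_of_continuousOn
    Complex.continuous_cosh.continuousOn
  -- The strip bounds the exponential and the unit ball bounds the hyperbolic functions. The
  -- derivative is then dominated by a multiple of `‖x‖ ‖f x‖`, integrable for Schwartz `f`.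
  have hs : strip ∩ Metric.ball ζ₀ 1 ∈ 𝓝 ζ₀ :=
    inter_mem (isOpen_strip.mem_nhds hζ₀) (Metric.ball_mem_nhds _ one_pos)
  have hbound : Integrable fun x : Spacetime => (m * (K₁ + K₂)) * (‖x‖ ^ 1 * ‖f x‖) :=
    (f.integrable_pow_mul volume 1).const_mul _
  refine (hasDerivAt_integral_of_dominated_loc_of_deriv_le
    (F := fun ζ x => f x * Complex.exp (-(Complex.I * phase m ζ x)))
    (F' := fun ζ x => f x * (Complex.exp (-(Complex.I * phase m ζ x)) *
      -(Complex.I * (m * (Complex.sinh ζ * x 0 - Complex.cosh ζ * x 1))))) hs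
    (Eventually.of_forall fun ζ => (continuous_integrand m f ζ).aestronglyMeasurable)
    ?_ ?_ (Eventually.of_forall fun x ζ hζ => ?_) hbound
    (Eventually.of_forall fun x ζ hζ => ?_)).2.differentiableAt
  · exact f.integrable.mono (continuous_integrand m f ζ₀).aestronglyMeasurable
      (Eventually.of_forall (norm_integrand_le hm hf (strip_subset_closedStrip hζ₀)))
  · refine Continuous.aestronglyMeasurable ?_
    have := continuous_phase m ζ₀
    have := f.continuous
    fun_prop
  · have h1 := norm_integrand_le hm hf (strip_subset_closedStrip hζ.1) x
    have h2 := hK₁ ζ (Metric.ball_subset_closedBall hζ.2)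
    have h3 := hK₂ ζ (Metric.ball_subset_closedBall hζ.2)
    have h4 : ‖((x 0 : ℝ) : ℂ)‖ ≤ ‖x‖ := by
      rw [Complex.norm_real]
      exact PiLp.norm_apply_le x 0
    have h5 : ‖((x 1 : ℝ) : ℂ)‖ ≤ ‖x‖ := by
      rw [Complex.norm_real]
      exact PiLp.norm_apply_le x 1
    have h6 : ‖Complex.sinh ζ * x 0 - Complex.cosh ζ * x 1‖ ≤ K₁ * ‖x‖ + K₂ * ‖x‖ := by
      refine (norm_sub_le _ _).trans (add_le_add ?_ ?_)
      · rw [norm_mul]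
        exact mul_le_mul h2 h4 (norm_nonneg _) ((norm_nonneg _).trans h2)
      · rw [norm_mul]
        exact mul_le_mul h3 h5 (norm_nonneg _) ((norm_nonneg _).trans h3)
    rw [← mul_assoc, norm_mul _ (-_), norm_neg, norm_mul Complex.I, norm_mul (m : ℂ),
      Complex.norm_I, one_mul, Complex.norm_real, Real.norm_of_nonneg hm.le]
    calc _ ≤ ‖f x‖ * (m * (K₁ * ‖x‖ + K₂ * ‖x‖)) :=
          mul_le_mul h1 (mul_le_mul_of_nonneg_left h6 hm.le) (by positivity) (norm_nonneg _)
      _ = _ := by ring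
  · exact ((((hasDerivAt_phase m ζ x).const_mul Complex.I).neg).cexp).const_mul _

/-- Requiring only `cosh (s R) → ∞` covers both ends of the strip at once. The decay is not uniform
in `y`, since `sin y` degenerates at the edges. -/
lemma tendsto_contFun_vertical {m : ℝ} (hm : 0 < m) {f : 𝓢(Spacetime, ℂ)}
    (hf : Function.support f ⊆ rightWedge) {y : ℝ} (hy : y ∈ Set.Ioo 0 Real.pi) {s : ℝ → ℝ}
    (hs : Tendsto (fun R => Real.cosh (s R)) atTop atTop) :
    Tendsto (fun R => contFun m f (s R + y * Complex.I)) atTop (𝓝 0) := by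
  have hstrip : ∀ R, (s R + y * Complex.I : ℂ) ∈ closedStrip := fun R => by
    constructor <;> simp [hy.1.le, hy.2.le]
  rw [← mul_zero (1 / (2 * Real.pi) : ℂ), ← integral_zero Spacetime ℂ]
  refine Tendsto.const_mul _ (tendsto_integral_filter_of_dominated_convergence (fun x => ‖f x‖)
    (Eventually.of_forall fun R => (continuous_integrand m f _).aestronglyMeasurable)
    (Eventually.of_forall fun R => Eventually.of_forall (norm_integrand_le hm hf (hstrip R)))
    f.integrable.norm (Eventually.of_forall fun x => ?_))
  by_cases hx : f x = 0
  · simp [hx]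
  · have hpos : 0 < m * Real.sin y * (x 1 - |x 0|) :=
      mul_pos (mul_pos hm (Real.sin_pos_of_pos_of_lt_pi hy.1 hy.2)) (sub_pos.2 (hf hx))
    have h1 : Tendsto (fun R => Real.exp (-(m * Real.sin y * (x 1 - |x 0|)) * Real.cosh (s R)))
        atTop (𝓝 0) :=
      Real.tendsto_exp_atBot.comp (hs.const_mul_atTop_of_neg (neg_neg_of_pos hpos))
    have h2 : Tendsto (fun R => Complex.exp (-(Complex.I * phase m (s R + y * Complex.I) x)))
        atTop (𝓝 0) := by
      refine squeeze_zero_norm (fun R => ?_) h1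
      rw [norm_exp_phase]
      refine Real.exp_le_exp.2 ((phase_im_le hm (hstrip R) x).trans (le_of_eq ?_))
      simp
    simpa using h2.const_mul (f x)

/-- Cauchy's theorem for the strip `S(0,π)`. -/
lemma integral_strip_boundary_eq {h : ℂ → ℂ} (hc : ContinuousOn h closedStrip)
    (hd : DifferentiableOn ℂ h strip) {C : ℝ} (hC : ∀ ζ ∈ closedStrip, ‖h ζ‖ ≤ C)
    (hv : ∀ y ∈ Set.Ioo 0 Real.pi, ∀ s : ℝ → ℝ, Tendsto (fun R => Real.cosh (s R)) atTop atTop →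
      Tendsto (fun R => h (s R + y * Complex.I)) atTop (𝓝 0))
    (h0 : Integrable fun t : ℝ => h t)
    (hπ : Integrable fun t : ℝ => h (t + Real.pi * Complex.I)) :
    ∫ t : ℝ, h t = ∫ t : ℝ, h (t + Real.pi * Complex.I) := by
  have hvert : ∀ s : ℝ → ℝ, Tendsto (fun R => Real.cosh (s R)) atTop atTop →
      Tendsto (fun R => ∫ y in (0 : ℝ)..Real.pi, h (s R + y * Complex.I)) atTop (𝓝 0) := by
    intro s hs
    have hz : ∫ _y in (0 : ℝ)..Real.pi, (0 : ℂ) = 0 := intervalIntegral.integral_zero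
    rw [← hz]
    have hmem : ∀ R, ∀ y ∈ Set.Icc 0 Real.pi, (s R + y * Complex.I : ℂ) ∈ closedStrip := by
      intro R y hy
      constructor <;> simp [hy.1, hy.2]
    refine intervalIntegral.tendsto_integral_filter_of_dominated_convergence (fun _ => C)
      (Eventually.of_forall fun R => ?_) (Eventually.of_forall fun R => ?_)
      intervalIntegrable_const ?_
    · rw [Set.uIoc_of_le Real.pi_pos.le]
      refine ContinuousOn.aestronglyMeasurable ?_ measurableSet_Ioc
      refine hc.comp (by fun_prop) fun y hy => hmem R y (Set.Ioc_subset_Icc_self hy)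
    · refine Eventually.of_forall fun y hy => ?_
      rw [Set.uIoc_of_le Real.pi_pos.le] at hy
      exact hC _ (hmem R y (Set.Ioc_subset_Icc_self hy))
    · have hne : ∀ᵐ y : ℝ, y ≠ Real.pi := by simp [ae_iff]
      filter_upwards [hne] with y hy1 hy
      rw [Set.uIoc_of_le Real.pi_pos.le] at hy
      exact hv y ⟨hy.1, lt_of_le_of_ne hy.2 hy1⟩ s hs
  have hcosh : Tendsto Real.cosh atTop atTop :=
    tendsto_atTop_mono (fun x => by
      rw [Real.cosh_eq]
      have := Real.exp_pos (-x)
      linarith) (Real.tendsto_exp_atTop.atTop_div_const (two_pos : (0 : ℝ) < 2))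
  have hr := hvert (fun R => R) hcosh
  have hl := hvert (fun R => -R) (by simpa using hcosh)
  have hb := intervalIntegral_tendsto_integral h0 tendsto_neg_atTop_atBot tendsto_id
  have ht := intervalIntegral_tendsto_integral hπ tendsto_neg_atTop_atBot tendsto_id
  have hrect : ∀ᶠ R : ℝ in atTop, (∫ x : ℝ in -R..R, h x) -
      (∫ x : ℝ in -R..R, h (x + Real.pi * Complex.I)) +
      Complex.I * (∫ y in (0 : ℝ)..Real.pi, h ((R : ℝ) + y * Complex.I)) -
      Complex.I * (∫ y in (0 : ℝ)..Real.pi, h ((-R : ℝ) + y * Complex.I)) = 0 := by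
    filter_upwards [eventually_gt_atTop 0] with R hR
    have := Complex.integral_boundary_rect_eq_zero_of_continuousOn_of_differentiableOn h
      ((-R : ℝ) : ℂ) (R + Real.pi * Complex.I) (hc.mono ?_) (hd.mono ?_)
    · simpa using this
    · rintro ζ ⟨-, hζ⟩
      simp [Set.uIcc_of_le Real.pi_pos.le] at hζ
      exact hζ
    · rintro ζ ⟨-, hζ⟩
      simp [min_eq_left Real.pi_pos.le, max_eq_right Real.pi_pos.le] at hζ
      exact hζ
  have hlim := (((hb.sub ht).add (hr.const_mul Complex.I)).sub (hl.const_mul Complex.I))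
  have h1 := tendsto_nhds_unique (hlim.congr' hrect) tendsto_const_nhds
  simp only [mul_zero, add_zero, sub_zero] at h1
  exact sub_eq_zero.1 h1

/-! ### Crossing symmetry and equality of the exchange integrals -/

lemma ScatteringFunction.toFun_add_pi (S : ScatteringFunction) (θ : ℝ) :
    S.toFun (θ + Real.pi * Complex.I) = S.onReal (-θ) := by
  rw [← S.neg_eq_crossing, ScatteringFunction.onReal, Complex.ofReal_neg]

lemma integrable_mul_prod_onReal (S : ScatteringFunction) {u v : ℝ → ℂ} (hu : MemLp u 2 volume)
    (hv : MemLp v 2 volume) {ι : Type*} [Fintype ι] (a : ι → ℝ → ℝ) (ha : ∀ j, Continuous (a j)) :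
    Integrable fun t => u t * v t * ∏ j, S.onReal (a j t) := by
  refine (hu.integrable_mul hv).mono ((hu.1.mul hv.1).mul (Continuous.aestronglyMeasurable ?_))
    (Eventually.of_forall fun t => ?_)
  · exact continuous_finsetProd _ fun j _ => S.continuous_onReal.comp (ha j)
  · rw [norm_mul, norm_prod, Finset.prod_eq_one fun j _ => S.norm_onReal _, mul_one]
    rfl

theorem integral_minusFun_mul_plusFun (S : ScatteringFunction) {m : ℝ} (hm : 0 < m)
    {f g : 𝓢(Spacetime, ℂ)} (hf : Function.support f ⊆ rightWedge)
    (hg : Function.support g ⊆ leftWedge) {n : ℕ} (θ : Fin n → ℝ) :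
    ∫ t : ℝ, minusFun m f t * plusFun m g t * ∏ j, S.onReal (t - θ j) =
      ∫ t : ℝ, plusFun m f t * minusFun m g t * ∏ j, S.onReal (θ j - t) := by
  have hg' : Function.support (negTest g) ⊆ rightWedge := fun x hx => by
    have h := hg (show -x ∈ Function.support g from hx)
    rwa [leftWedge, Set.mem_ofPred_eq, neg_neg] at h
  obtain ⟨B, hB⟩ := S.bounded
  -- The reflected `g` is supported in the right wedge, so all factors continue to the same strip.
  -- The lower edge carries `f⁻ g⁺` and the upper edge `f⁺ g⁻`.
  set h : ℂ → ℂ := fun ζ => contFun m f ζ * contFun m (negTest g) ζ * ∏ j, S.toFun (ζ - θ j)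
  have hsub : ∀ {ζ : ℂ} (t : ℝ), ζ ∈ closedStrip → ζ - t ∈ closedStrip := fun t hζ => by
    simpa [closedStrip] using hζ
  have hsub' : ∀ {ζ : ℂ} (t : ℝ), ζ ∈ strip → ζ - t ∈ strip := fun t hζ => by
    simpa [strip] using hζ
  have hprod : ∀ ζ ∈ closedStrip, ‖∏ j, S.toFun (ζ - θ j)‖ ≤ B ^ n := fun ζ hζ => by
    rw [norm_prod]
    refine (Finset.prod_le_prod (fun _ _ => norm_nonneg _)
      fun j _ => hB _ (hsub (θ j) hζ)).trans (le_of_eq ?_)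
    simp
  have e0 : ∀ t : ℝ, h t = minusFun m f t * plusFun m g t * ∏ j, S.onReal (t - θ j) := fun t => by
    simp only [h, ← minusFun_eq_contFun, minusFun_negTest, ScatteringFunction.onReal,
      Complex.ofReal_sub]
  have eπ : ∀ t : ℝ, h (t + Real.pi * Complex.I) =
      plusFun m f t * minusFun m g t * ∏ j, S.onReal (θ j - t) := fun t => by
    simp only [h, ← plusFun_eq_contFun, plusFun_negTest]
    congr 1
    refine Finset.prod_congr rfl fun j _ => ?_
    -- Crossing: `S₂(θ_j - t)` is the value of `S₂` at `t - θ_j + iπ`.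
    rw [← neg_sub t, ← S.toFun_add_pi, Complex.ofReal_sub]
    congr 1
    ring
  have key : ∫ t : ℝ, h t = ∫ t : ℝ, h (t + Real.pi * Complex.I) := by
    refine integral_strip_boundary_eq (C := (‖(1 / (2 * Real.pi) : ℂ)‖ * ∫ x, ‖f x‖) *
      (‖(1 / (2 * Real.pi) : ℂ)‖ * ∫ x, ‖negTest g x‖) * B ^ n) ?_ ?_ ?_ ?_ ?_ ?_
    · refine ((continuousOn_contFun hm hf).mul (continuousOn_contFun hm hg')).mul
        (continuousOn_finsetProd _ fun j _ => ?_)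
      exact S.continuousOn.comp (by fun_prop) fun ζ hζ => hsub (θ j) hζ
    · refine ((differentiableOn_contFun hm hf).mul (differentiableOn_contFun hm hg')).mul
        (DifferentiableOn.fun_finsetProd fun j _ => ?_)
      exact S.analytic.differentiableOn.comp (by fun_prop) fun ζ hζ => hsub' (θ j) hζ
    · intro ζ hζ
      simp only [h, norm_mul]
      have h1 := norm_contFun_le hm hf hζ
      have h2 := norm_contFun_le hm hg' hζ
      exact mul_le_mul (mul_le_mul h1 h2 (norm_nonneg _) ((norm_nonneg _).trans h1))
        (hprod ζ hζ) (norm_nonneg _)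
        (mul_nonneg ((norm_nonneg _).trans h1) ((norm_nonneg _).trans h2))
    · intro y hy s hs
      have h1 := (tendsto_contFun_vertical hm hf hy hs).mul (tendsto_contFun_vertical hm hg' hy hs)
      rw [zero_mul] at h1
      refine h1.zero_mul_isBoundedUnder_le ?_
      refine isBoundedUnder_of ⟨B ^ n, fun R => hprod _ ?_⟩
      constructor <;> simp [hy.1.le, hy.2.le]
    · simp only [e0]
      exact integrable_mul_prod_onReal S (memLp_minusFun hm f) (memLp_plusFun hm g) _
        fun j => by fun_prop
    · simp only [eπ]
      exact integrable_mul_prod_onReal S (memLp_plusFun hm f) (memLp_minusFun hm g) _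
        fun j => by fun_prop
  simpa only [e0, eπ] using key

end

end WedgeLocal

theorem mainTheorem6 (S : WedgeLocal.ScatteringFunction) (m : ℝ) (hm : 0 < m)
    (f g : 𝓢(WedgeLocal.Spacetime, ℂ))
    (hf : Function.support f ⊆ WedgeLocal.rightWedge)
    (hg : Function.support g ⊆ WedgeLocal.leftWedge)
    (Ψ : WedgeLocal.domain S) :
    ⁅WedgeLocal.reflectedField S hm f, WedgeLocal.field S hm g⁆ Ψ = 0 := by
  open WedgeLocal in
  have hR : reflectedField S hm f =
      reflectedZCre S (plusVec hm (starTest f)) + reflectedZAnn S (minusVec hm (starTest f)) := by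
    refine LinearMap.ext fun Φ => ?_
    exact map_add (J S) _ _
  rw [Ring.lie_def, LinearMap.sub_apply, Module.End.mul_apply, Module.End.mul_apply, hR, sub_eq_zero]
  -- The vectors are `ψ₁ = (f*)⁻`, `ψ₂ = (f*)⁺`, `χ₁ = g⁺` and `χ₂ = g⁻`. Passing to representatives
  -- and conjugating reduces the hypothesis to the integral identity for `f` and `g`.
  refine WedgeLocal.commutator_eq_zero S _ _ _ _ (fun n θ => ?_) Ψ
  refine Eq.trans (integral_congr_ae ?_)
    ((WedgeLocal.integral_minusFun_mul_plusFun S hm hf hg θ).trans (integral_congr_ae ?_))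
  · filter_upwards [(WedgeLocal.memLp_minusFun hm (WedgeLocal.starTest f)).coeFn_toLp,
      (WedgeLocal.memLp_plusFun hm g).coeFn_toLp] with t h1 h2
    rw [WedgeLocal.minusVec, WedgeLocal.plusVec, h1, h2, WedgeLocal.minusFun_starTest]
  · filter_upwards [(WedgeLocal.memLp_plusFun hm (WedgeLocal.starTest f)).coeFn_toLp,
      (WedgeLocal.memLp_minusFun hm g).coeFn_toLp] with t h1 h2
    rw [WedgeLocal.minusVec, WedgeLocal.plusVec, h1, h2, WedgeLocal.plusFun_starTest,
      mul_comm (WedgeLocal.minusFun m g t)]
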